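/- Let $G$ be a locally compact group with a fixed left Haar measure, and let $A$ be a complex Banach algebra that has a contractive (two-sided) approximate identity and is nondegenerate, i.e. has an isometric nondegenerate representation on some Banach space. Let $M(A)$ be its multiplier algebra (double centralizers), let $\mathrm{Inv}_1(M(A))$ be the set of invertible $u\in M(A)$ with $\|u\|=\|u^{-1}\|=1$, let $\mathrm{Ad}(u)a=uau^{-1}$, and let $\mathrm{Aut}(A)$ be the group of isometric algebra automorphisms of $A$, each extended to $M(A)$ by $\varphi(t)\varphi(a)=\varphi(ta)$, $\varphi(a)\varphi(t)=\varphi(at)$. A *twisted action* of $G$ on $A$ is a pair $(\alpha,\sigma)$ of maps $\alpha\colon G\to\mathrm{Aut}(A)$ and $\sigma\colon G\times G\to\mathrm{Inv}_1(M(A))$ such that $x\mapsto\alpha_x(a)$, $(x,y)\mapsto\sigma_{x,y}a$ and $(x,y)\mapsto a\sigma_{x,y}$ are continuous for every $a\in A$, $\alpha_1=\mathrm{id}$, $\sigma_{1,x}=\sigma_{x,1}=1$, $\alpha_x\alpha_y=\mathrm{Ad}(\sigma_{x,y})\circ\alpha_{xy}$, and $\alpha_z(\sigma_{x,y})\sigma_{z,xy}=\sigma_{z,x}\sigma_{zx,y}$.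 A *covariant representation* of $(G,A,\alpha,\sigma)$ on a Banach space $E$ is a pair $(\pi,u)$, where $\pi\colon A\to\mathcal B(E)$ is a bounded nondegenerate representation and $u$ is a strongly continuous map from $G$ to the invertible isometries of $E$, with $u_xu_y=\widehat\pi(\sigma_{x,y})u_{xy}$ and $\pi(\alpha_x(a))=u_x\pi(a)u_x^{-1}$; here $\widehat\pi\colon M(A)\to\mathcal B(E)$ is the unique extension of $\pi$, determined by $\widehat\pi(m)\pi(a)=\pi(ma)$. It is *contractive* if $\|\pi\|\le1$. Let $L^1(G,A,\alpha,\sigma)$ be $L^1(G;A)$ with the product $(f*g)(x)=\int_G f(y)\,\alpha_y(g(y^{-1}x))\,\sigma_{y,y^{-1}x}\,dy$, and let $(\pi\rtimes u)(f)=\int_G\pi(f(x))u_x\,dx$. For a nonempty family $\mathcal R$ of covariant representations with $\sup_{(\pi,u)\in\mathcal R}\|\pi\|<\infty$, the crossed product $F_{\mathcal R}(G,A,\alpha,\sigma)$ is the Banach algebra obtained as the Hausdorff completion of $L^1(G,A,\alpha,\sigma)$ with respect to the seminorm $\|f\|_{\mathcal R}=\sup_{(\pi,u)\in\mathcal R}\|(\pi\rtimes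 u)(f)\|$. Let $(\alpha,\sigma)$ and $(\beta,\omega)$ be twisted actions of $G$ on $A$ that are exterior equivalent via a map $\theta\colon G\to\mathrm{Inv}_1(M(A))$: the maps $x\mapsto\theta_xa$ and $x\mapsto a\theta_x$ are continuous for every $a\in A$, $\beta_x=\mathrm{Ad}(\theta_x)\circ\alpha_x$, and $\omega_{x,y}\theta_{xy}=\theta_x\alpha_x(\theta_y)\sigma_{x,y}$ for all $x,y\in G$. Let $\mathcal R$ be a nonempty family of contractive covariant representations of $(G,A,\alpha,\sigma)$, and let $\mathcal R_\theta=\{(\pi,\,x\mapsto\widehat\pi(\theta_x)u_x):(\pi,u)\in\mathcal R\}$, which is a family of contractive covariant representations of $(G,A,\beta,\omega)$. Then $F_{\mathcal R}(G,A,\alpha,\sigma)$ and $F_{\mathcal R_\theta}(G,A,\beta,\omega)$ are isometrically isomorphic as Banach algebras, i.e. there is a surjective linear isometry between them that preserves products. -/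

import Mathlib

open MeasureTheory Filter Topology
open scoped MultiplierAlgebra ENNReal

noncomputable section

universe u v w

namespace TwistedCrossedProduct

section Fields

variable {X F E : Type*} [TopologicalSpace X]
  [NormedAddCommGroup F] [NormedSpace ℂ F] [NormedAddCommGroup E] [NormedSpace ℂ E]

/-- A strongly continuous, uniformly bounded field of operators `F → E` over the space `X`. -/
structure OperatorField (X F E : Type*) [TopologicalSpace X] [NormedAddCommGroup F]
    [NormedSpace ℂ F] [NormedAddCommGroup E] [NormedSpace ℂ E] where
  /-- the operator at a point of `X` -/
  op : X → F →L[ℂ] E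
  bounded : ∃ C : ℝ, ∀ x, ‖op x‖ ≤ C
  continuous : ∀ a, Continuous fun x => op x a

theorem OperatorField.exists_bound (T : OperatorField X F E) :
    ∃ C : ℝ, 0 ≤ C ∧ ∀ x a, ‖T.op x a‖ ≤ C * ‖a‖ := by
  obtain ⟨C, hC⟩ := T.bounded
  refine ⟨max C 0, le_max_right _ _, fun x a => (T.op x).le_of_opNorm_le ?_ a⟩
  exact (hC x).trans (le_max_left _ _)

theorem OperatorField.continuous_apply (T : OperatorField X F E) {f : X → F}
    (hf : Continuous f) : Continuous fun x => T.op x (f x) := by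
  obtain ⟨C, hC0, hC⟩ := T.exists_bound
  rw [continuous_iff_continuousAt]
  intro x₀
  have h1 : Tendsto (fun x => T.op x (f x₀)) (𝓝 x₀) (𝓝 (T.op x₀ (f x₀))) :=
    (T.continuous (f x₀)).tendsto x₀
  have h2 : Tendsto (fun x => T.op x (f x - f x₀)) (𝓝 x₀) (𝓝 0) := by
    refine squeeze_zero_norm (fun x => hC x _) ?_
    have h3 : Tendsto (fun x => C * ‖f x - f x₀‖) (𝓝 x₀) (𝓝 (C * ‖f x₀ - f x₀‖)) :=
      (continuous_const.mul (hf.sub continuous_const).norm).tendsto x₀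
    simpa using h3
  have h4 := h1.add h2
  simpa [ContinuousAt] using h4

variable [MeasurableSpace X] [BorelSpace X] [R1Space X] [LocallyCompactSpace X]
  {ν : Measure X} [ν.Regular]

theorem exists_hasCompactSupport_approx {f : X → F} (hf : Integrable f ν) {ε : ℝ≥0∞}
    (hε : ε ≠ 0) : ∃ g : X → F, eLpNorm (f - g) 1 ν ≤ ε ∧ Continuous g ∧ HasCompactSupport g := by
  refine (memLp_one_iff_integrable.2 hf).induction_dense ENNReal.one_ne_top
    (fun g => Continuous g ∧ HasCompactSupport g) (fun c s hs hsν δ hδ => ?_)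
    (fun g h hg hh => ?_) (fun g hg => (hg.1.stronglyMeasurable_of_hasCompactSupport hg.2).aestronglyMeasurable) hε
  rotate_left
  · obtain ⟨hg1, hg2⟩ := hg
    obtain ⟨hh1, hh2⟩ := hh
    exact ⟨hg1.add hh1, hg2.add hh2⟩
  obtain ⟨η, hη0, hη⟩ := exists_eLpNorm_indicator_le (μ := ν) ENNReal.one_ne_top c hδ
  have hη2 : ((η : ℝ≥0∞) / 2) ≠ 0 := by simpa using hη0.ne'
  obtain ⟨K, hKs, hK, hKc, hKν⟩ := hs.exists_isCompact_isClosed_sdiff_lt hsν.ne hη2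
  obtain ⟨U, hsU, hU, -, hUν⟩ := hs.exists_isOpen_sdiff_lt hsν.ne hη2
  obtain ⟨φ, hφ1, hφ0, hφc, hφI⟩ := exists_continuous_one_zero_of_isCompact hK hU.isClosed_compl
    (Set.disjoint_compl_right_iff_subset.2 (hKs.trans hsU))
  have hcc : Continuous fun x => φ x • c := by fun_prop
  have hcs : HasCompactSupport fun x => φ x • c :=
    hφc.mono fun x hx h0 => hx (by simp [h0])
  refine ⟨fun x => φ x • c, ?_, hcc, hcs⟩
  have hm : ν (U \ K) ≤ η := by
    have hsub : U \ K ⊆ (U \ s) ∪ (s \ K) := by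
      intro x hx
      by_cases hxs : x ∈ s
      · exact Or.inr ⟨hxs, hx.2⟩
      · exact Or.inl ⟨hx.1, hxs⟩
    refine (measure_mono hsub).trans ((measure_union_le _ _).trans ?_)
    exact (add_le_add hUν.le hKν.le).trans (ENNReal.add_halves _).le
  refine (eLpNorm_mono fun x => ?_).trans (hη (U \ K) hm)
  by_cases hxK : x ∈ K
  · have h1 : φ x = 1 := hφ1 hxK
    simp [h1, hKs hxK, hxK]
  · by_cases hxU : x ∈ U
    · have hx : x ∈ U \ K := ⟨hxU, hxK⟩
      have h0 := (hφI x).1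
      have h1 := (hφI x).2
      by_cases hxs : x ∈ s
      · simp only [Pi.sub_apply, Set.indicator_of_mem hxs, Set.indicator_of_mem hx]
        have : φ x • c - c = (φ x - 1) • c := by rw [sub_smul, one_smul]
        rw [this, norm_smul]
        refine mul_le_of_le_one_left (norm_nonneg c) ?_
        rw [Real.norm_eq_abs, abs_le]
        constructor <;> linarith
      · simp only [Pi.sub_apply, Set.indicator_of_notMem hxs, Set.indicator_of_mem hx, sub_zero]
        rw [norm_smul]
        refine mul_le_of_le_one_left (norm_nonneg c) ?_
        rw [Real.norm_eq_abs, abs_le]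
        constructor <;> linarith
    · have h0 : φ x = 0 := hφ0 hxU
      have hxs : x ∉ s := fun h => hxU (hsU h)
      simp [h0, hxs]

theorem OperatorField.aestronglyMeasurable_apply (T : OperatorField X F E) {f : X → F}
    (hf : Integrable f ν) : AEStronglyMeasurable (fun x => T.op x (f x)) ν := by
  have hε : ∀ n : ℕ, ((n : ℝ≥0∞) + 1)⁻¹ ≠ 0 := fun n => by simp
  choose g hgl hgc hgs using fun n : ℕ => exists_hasCompactSupport_approx hf (hε n)
  have hlim : Tendsto (fun n => eLpNorm (g n - f) 1 ν) atTop (𝓝 0) := by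
    have h0 : Tendsto (fun n : ℕ => ((n : ℝ≥0∞) + 1)⁻¹) atTop (𝓝 0) := by
      have := (tendsto_add_atTop_iff_nat 1).2 ENNReal.tendsto_inv_nat_nhds_zero
      simpa using this
    refine tendsto_of_tendsto_of_tendsto_of_le_of_le tendsto_const_nhds h0
      (fun _ => zero_le) (fun n => ?_)
    rw [eLpNorm_sub_comm]
    exact hgl n
  have hm := tendstoInMeasure_of_tendsto_eLpNorm one_ne_zero
    (fun n => ((hgc n).stronglyMeasurable_of_hasCompactSupport (hgs n)).aestronglyMeasurable) hf.1 hlim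
  obtain ⟨ns, -, hns⟩ := hm.exists_seq_tendsto_ae
  refine aestronglyMeasurable_of_tendsto_ae atTop
    (f := fun n x => T.op x (g (ns n) x)) (fun n => ?_) ?_
  · refine ((T.continuous_apply (hgc (ns n))).stronglyMeasurable_of_hasCompactSupport
      ?_).aestronglyMeasurable
    exact (hgs (ns n)).mono fun x hx h0 => hx (by simp [h0])
  · filter_upwards [hns] with x hx
    exact ((T.op x).continuous.tendsto _).comp hx

theorem OperatorField.integrable_apply (T : OperatorField X F E) {f : X → F}
    (hf : Integrable f ν) : Integrable (fun x => T.op x (f x)) ν := by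
  obtain ⟨C, -, hC⟩ := T.exists_bound
  exact (hf.norm.const_mul C).mono' (T.aestronglyMeasurable_apply hf)
    (Eventually.of_forall fun x => hC x _)

/-- The operator `f ↦ (x ↦ T x (f x))` from `L¹(X; F)` to `L¹(X; E)`. -/
def OperatorField.mapL1 (T : OperatorField X F E) (ν : Measure X) [ν.Regular] :
    Lp F 1 ν →L[ℂ] Lp E 1 ν :=
  LinearMap.mkContinuousOfExistsBound
    { toFun := fun f => (T.integrable_apply (L1.integrable_coeFn f)).toL1 _
      map_add' := fun f g => by
        rw [← Integrable.toL1_add]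
        refine (Integrable.toL1_eq_toL1_iff _ _ _ _).2 ?_
        filter_upwards [Lp.coeFn_add f g] with x hx
        rw [hx]
        simp
      map_smul' := fun c f => by
        rw [RingHom.id_apply, ← Integrable.toL1_smul]
        refine (Integrable.toL1_eq_toL1_iff _ _ _ _).2 ?_
        filter_upwards [Lp.coeFn_smul c f] with x hx
        rw [hx]
        simp } <| by
    obtain ⟨C, hC0, hC⟩ := T.exists_bound
    refine ⟨C, fun f => ?_⟩
    have h := L1.norm_of_fun_eq_integral_norm (T.integrable_apply (L1.integrable_coeFn f))
    refine (le_of_eq h).trans ?_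
    rw [L1.norm_eq_integral_norm f, ← integral_const_mul]
    exact integral_mono (T.integrable_apply (L1.integrable_coeFn f)).norm
      ((L1.integrable_coeFn f).norm.const_mul C) (fun x => hC x _)

theorem OperatorField.coeFn_mapL1 (T : OperatorField X F E) (f : Lp F 1 ν) :
    T.mapL1 ν f =ᵐ[ν] fun x => T.op x (f x) :=
  Integrable.coeFn_toL1 (T.integrable_apply (L1.integrable_coeFn f))

theorem OperatorField.norm_mapL1_le (T : OperatorField X F E) {C : ℝ} (_hC0 : 0 ≤ C)
    (hC : ∀ x a, ‖T.op x a‖ ≤ C * ‖a‖) (f : Lp F 1 ν) : ‖T.mapL1 ν f‖ ≤ C * ‖f‖ := by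
  rw [L1.norm_eq_integral_norm, L1.norm_eq_integral_norm f, ← integral_const_mul]
  refine integral_mono_ae (L1.integrable_coeFn _).norm
    ((L1.integrable_coeFn f).norm.const_mul C) ?_
  filter_upwards [T.coeFn_mapL1 f] with x hx
  rw [hx]
  exact hC x _

/-- A family `y ↦ T y` of operator fields over `X` that is jointly strongly continuous and
uniformly bounded gives a strongly continuous field of operators `L¹(X; F) → L¹(X; E)`. -/
def OperatorField.mapL1Field {Y : Type*} [TopologicalSpace Y] (T : Y → OperatorField X F E)
    (hb : ∃ C : ℝ, ∀ y x, ‖(T y).op x‖ ≤ C)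
    (hc : ∀ a, Continuous fun p : Y × X => (T p.1).op p.2 a) (ν : Measure X) [ν.Regular] :
    OperatorField Y (Lp F 1 ν) (Lp E 1 ν) where
  op := fun y => (T y).mapL1 ν
  bounded := by
    obtain ⟨C, hC⟩ := hb
    refine ⟨max C 0, fun y => ContinuousLinearMap.opNorm_le_bound _ (le_max_right _ _) fun f =>
      OperatorField.norm_mapL1_le (T y) (le_max_right _ _) (fun x a => ?_) f⟩
    exact ((T y).op x).le_of_opNorm_le ((hC y x).trans (le_max_left _ _)) a
  continuous := fun f => by
    obtain ⟨C, hC⟩ := hb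
    have hC' : ∀ y x a, ‖(T y).op x a‖ ≤ max C 0 * ‖a‖ := fun y x a =>
      ((T y).op x).le_of_opNorm_le ((hC y x).trans (le_max_left _ _)) a
    have hC0 : 0 ≤ max C 0 := le_max_right _ _
    generalize max C 0 = D at hC' hC0
    have key : ∀ y (f g : Lp F 1 ν), ‖(T y).mapL1 ν f - (T y).mapL1 ν g‖ ≤ D * ‖f - g‖ := by
      intro y f g
      rw [← map_sub]
      exact OperatorField.norm_mapL1_le (T y) hC0 (hC' y) _
    rw [continuous_iff_continuousAt]
    intro y₀
    rw [ContinuousAt, Metric.tendsto_nhds]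
    intro ε hε
    obtain ⟨δ, hδ, hδε⟩ : ∃ δ : ℝ, 0 < δ ∧ D * δ < ε / 3 := by
      refine ⟨ε / 3 / (D + 1), by positivity, ?_⟩
      rw [mul_div_assoc', div_lt_iff₀ (by positivity)]
      nlinarith
    obtain ⟨g, hgf, hgc, hgs⟩ := exists_hasCompactSupport_approx (L1.integrable_coeFn f)
      (ENNReal.ofReal_pos.2 hδ).ne'
    have hgi : Integrable g ν := hgc.integrable_of_hasCompactSupport hgs
    have hfg : ‖f - hgi.toL1 g‖ ≤ δ := by
      rw [Lp.norm_def]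
      refine ENNReal.toReal_le_of_le_ofReal hδ.le (le_trans (le_of_eq ?_) hgf)
      refine eLpNorm_congr_ae ?_
      filter_upwards [Lp.coeFn_sub f (hgi.toL1 g), hgi.coeFn_toL1] with x h1 h2
      rw [h1, Pi.sub_apply, h2, Pi.sub_apply]
    have hcont : ∀ y, Continuous fun x => (T y).op x (g x) := fun y => (T y).continuous_apply hgc
    have hjoint : Continuous fun p : Y × X => (T p.1).op p.2 (g p.2) :=
      OperatorField.continuous_apply (X := Y × X)
        ⟨fun p => (T p.1).op p.2, ⟨C, fun p => hC p.1 p.2⟩, hc⟩ (hgc.comp continuous_snd)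
    have hI : ContinuousOn (fun y => ∫ x, ‖(T y).op x (g x) - (T y₀).op x (g x)‖ ∂ν)
        Set.univ := by
      refine continuousOn_integral_of_compact_support hgs ?_ ?_
      · refine Continuous.continuousOn (Continuous.norm (hjoint.sub ?_))
        exact (hcont y₀).comp continuous_snd
      · intro y x _ hx
        simp [image_eq_zero_of_notMem_tsupport hx]
    have hI0 := (continuousOn_univ.1 hI).tendsto y₀
    simp only [sub_self, norm_zero, integral_zero] at hI0
    filter_upwards [hI0.eventually_lt_const (show (0 : ℝ) < ε / 3 by positivity)] with y hy
    have h2 : ‖(T y).mapL1 ν (hgi.toL1 g) - (T y₀).mapL1 ν (hgi.toL1 g)‖ < ε / 3 := by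
      refine lt_of_eq_of_lt ?_ hy
      rw [L1.norm_eq_integral_norm]
      refine integral_congr_ae ?_
      filter_upwards [Lp.coeFn_sub ((T y).mapL1 ν (hgi.toL1 g)) ((T y₀).mapL1 ν (hgi.toL1 g)),
        (T y).coeFn_mapL1 (hgi.toL1 g), (T y₀).coeFn_mapL1 (hgi.toL1 g),
        hgi.coeFn_toL1] with x h1 h2 h3 h4
      rw [h1, Pi.sub_apply, h2, h3, h4]
    have h1 : ‖(T y).mapL1 ν f - (T y).mapL1 ν (hgi.toL1 g)‖ < ε / 3 :=
      ((key y _ _).trans (mul_le_mul_of_nonneg_left hfg hC0)).trans_lt hδε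
    have h3 : ‖(T y₀).mapL1 ν f - (T y₀).mapL1 ν (hgi.toL1 g)‖ < ε / 3 :=
      ((key y₀ _ _).trans (mul_le_mul_of_nonneg_left hfg hC0)).trans_lt hδε
    rw [dist_eq_norm]
    calc ‖(T y).mapL1 ν f - (T y₀).mapL1 ν f‖
        = ‖((T y).mapL1 ν f - (T y).mapL1 ν (hgi.toL1 g))
          + ((T y).mapL1 ν (hgi.toL1 g) - (T y₀).mapL1 ν (hgi.toL1 g))
          - ((T y₀).mapL1 ν f - (T y₀).mapL1 ν (hgi.toL1 g))‖ := by congr 1; abel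
      _ ≤ _ := (norm_sub_le _ _).trans (add_le_add_left (norm_add_le _ _) _)
      _ < ε := by linarith

end Fields

section Algebra

variable (A : Type*) [NonUnitalNormedRing A]

/-- `A` has a contractive two-sided approximate identity (a net, given by a proper filter on
`A`). -/
class HasCAI : Prop where
  exists_filter : ∃ l : Filter A, l.IsApproximateUnit ∧ ∀ᶠ e in l, ‖e‖ ≤ 1

variable {A}

theorem eq_of_forall_mul_eq [HasCAI A] {a b : A} (h : ∀ c, c * a = c * b) : a = b := by
  obtain ⟨l, hl, -⟩ := HasCAI.exists_filter (A := A)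
  have := hl.neBot
  refine tendsto_nhds_unique (hl.tendsto_mul_right a) ?_
  simpa only [h] using hl.tendsto_mul_right b

theorem eq_of_forall_mul_eq_right [HasCAI A] {a b : A} (h : ∀ c, a * c = b * c) : a = b := by
  obtain ⟨l, hl, -⟩ := HasCAI.exists_filter (A := A)
  have := hl.neBot
  refine tendsto_nhds_unique (hl.tendsto_mul_left a) ?_
  simpa only [h] using hl.tendsto_mul_left b

variable [NormedSpace ℂ A]

variable (A) in
/-- A nondegenerate representation of `A` on `E`: a bounded algebra homomorphism
`π : A → B(E)` such that the linear span of `π(A)E` is dense in `E`. -/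
structure NondegenerateRep (E : Type*) [NormedAddCommGroup E] [NormedSpace ℂ E] where
  /-- the underlying bounded linear map -/
  hom : A →L[ℂ] (E →L[ℂ] E)
  map_mul : ∀ a b, hom (a * b) = hom a * hom b
  nondegenerate : Dense (Submodule.span ℂ {η : E | ∃ a ξ, η = hom a ξ} : Set E)

/-- `A` is nondegenerate: it has an isometric nondegenerate representation on some
Banach space. -/
def IsNondegenerate (A : Type u) [NonUnitalNormedRing A] [NormedSpace ℂ A] : Prop :=
  ∃ (E : Type u) (_ : NormedAddCommGroup E) (_ : NormedSpace ℂ E) (_ : CompleteSpace E)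
    (π : NondegenerateRep A E), ∀ a, ‖π.hom a‖ = ‖a‖

variable [IsScalarTower ℂ A A] [SMulCommClass ℂ A A]

variable (A) in
/-- `Inv₁(M(A))`: the invertible multipliers `u` with `‖u‖ = ‖u⁻¹‖ = 1`. -/
def Inv₁ : Set (𝓜(ℂ, A))ˣ :=
  {u | ‖(u : 𝓜(ℂ, A))‖ = 1 ∧ ‖((u⁻¹ : (𝓜(ℂ, A))ˣ) : 𝓜(ℂ, A))‖ = 1}

theorem multiplier_norm_fst_le (m : 𝓜(ℂ, A)) : ‖m.fst‖ ≤ ‖m‖ := by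
  rw [DoubleCentralizer.norm_def]; exact norm_fst_le (DoubleCentralizer.toProdHom m)

theorem multiplier_norm_snd_le (m : 𝓜(ℂ, A)) : ‖m.snd‖ ≤ ‖m‖ := by
  rw [DoubleCentralizer.norm_def]; exact norm_snd_le (DoubleCentralizer.toProdHom m)

theorem fst_mul [HasCAI A] (m : 𝓜(ℂ, A)) (a b : A) : m.fst (a * b) = m.fst a * b :=
  eq_of_forall_mul_eq fun c => by rw [← m.central, ← mul_assoc, ← mul_assoc, m.central]

theorem snd_mul [HasCAI A] (m : 𝓜(ℂ, A)) (a b : A) : m.snd (a * b) = a * m.snd b :=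
  eq_of_forall_mul_eq_right fun c => by rw [m.central, mul_assoc, mul_assoc, m.central]

theorem snd_fst_comm [HasCAI A] (m n : 𝓜(ℂ, A)) (a : A) :
    m.snd (n.fst a) = n.fst (m.snd a) :=
  eq_of_forall_mul_eq_right fun c => by
    rw [m.central, ← fst_mul, ← fst_mul, m.central, fst_mul]

theorem fst_inv_fst (u : (𝓜(ℂ, A))ˣ) (a : A) :
    (u : 𝓜(ℂ, A)).fst (((u⁻¹ : (𝓜(ℂ, A))ˣ) : 𝓜(ℂ, A)).fst a) = a := by
  have h := congrArg (fun m : 𝓜(ℂ, A) => m.fst) u.mul_inv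
  rw [DoubleCentralizer.mul_fst, DoubleCentralizer.one_fst] at h
  exact DFunLike.congr_fun h a

theorem snd_snd_inv (u : (𝓜(ℂ, A))ˣ) (a : A) :
    (u : 𝓜(ℂ, A)).snd (((u⁻¹ : (𝓜(ℂ, A))ˣ) : 𝓜(ℂ, A)).snd a) = a := by
  have h := congrArg (fun m : 𝓜(ℂ, A) => m.snd) u.inv_mul
  rw [DoubleCentralizer.mul_snd, DoubleCentralizer.one_snd] at h
  exact DFunLike.congr_fun h a

/-- `Ad(u) a = u a u⁻¹` for an invertible multiplier `u`. For a multiplier `m = (L, R)`,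
the products `m a` and `a m` are `m.fst a = L a` and `m.snd a = R a`. -/
def Ad (u : (𝓜(ℂ, A))ˣ) (a : A) : A :=
  (u : 𝓜(ℂ, A)).fst (((u⁻¹ : (𝓜(ℂ, A))ˣ) : 𝓜(ℂ, A)).snd a)

variable (A) in
/-- `Aut(A)`: the isometric algebra automorphisms of `A`. -/
structure IsometricAut extends A ≃ₗᵢ[ℂ] A where
  map_mul' : ∀ a b, toFun (a * b) = toFun a * toFun b

instance : CoeFun (IsometricAut A) (fun _ => A → A) := ⟨fun φ => φ.toLinearIsometryEquiv⟩

theorem IsometricAut.map_mul (φ : IsometricAut A) (a b : A) : φ (a * b) = φ a * φ b :=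
  φ.map_mul' a b

/-- The lift of `φ ∈ Aut(A)` to `M(A)`, determined by `φ(m)φ(a) = φ(ma)` and
`φ(a)φ(m) = φ(am)`. -/
def IsometricAut.lift (φ : IsometricAut A) (m : 𝓜(ℂ, A)) : 𝓜(ℂ, A) where
  fst := φ.toLinearIsometryEquiv.toContinuousLinearEquiv.toContinuousLinearMap ∘L m.fst ∘L
    φ.toLinearIsometryEquiv.symm.toContinuousLinearEquiv.toContinuousLinearMap
  snd := φ.toLinearIsometryEquiv.toContinuousLinearEquiv.toContinuousLinearMap ∘L m.snd ∘L
    φ.toLinearIsometryEquiv.symm.toContinuousLinearEquiv.toContinuousLinearMap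
  central := fun x y => by
    obtain ⟨a, rfl⟩ := φ.toLinearIsometryEquiv.surjective x
    obtain ⟨b, rfl⟩ := φ.toLinearIsometryEquiv.surjective y
    have h := congrArg φ.toLinearIsometryEquiv (m.central a b)
    simpa [φ.map_mul] using h

theorem IsometricAut.lift_fst (φ : IsometricAut A) (m : 𝓜(ℂ, A)) (a : A) :
    (φ.lift m).fst (φ a) = φ (m.fst a) := by
  simp [IsometricAut.lift]

theorem IsometricAut.lift_snd (φ : IsometricAut A) (m : 𝓜(ℂ, A)) (a : A) :
    (φ.lift m).snd (φ a) = φ (m.snd a) := by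
  simp [IsometricAut.lift]

end Algebra

section Extension

variable {A : Type*} [NonUnitalNormedRing A] [NormedSpace ℂ A] [IsScalarTower ℂ A A]
  [SMulCommClass ℂ A A] [HasCAI A]
  {E : Type*} [NormedAddCommGroup E] [NormedSpace ℂ E]

theorem NondegenerateRep.ext_of_eq (π : NondegenerateRep A E) {S T : E →L[ℂ] E}
    (h : ∀ a ξ, S (π.hom a ξ) = T (π.hom a ξ)) : S = T := by
  refine ContinuousLinearMap.ext_on π.nondegenerate ?_
  rintro _ ⟨a, ξ, rfl⟩
  exact h a ξ

/-- For every multiplier `m` there is a bounded operator `S` with `S π(a) = π(ma)` for all `a`;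
its norm is at most `‖π‖ ‖m‖`. -/
theorem NondegenerateRep.exists_extension [CompleteSpace E] (π : NondegenerateRep A E)
    (m : 𝓜(ℂ, A)) : ∃ S : E →L[ℂ] E, (∀ a ξ, S (π.hom a ξ) = π.hom (m.fst a) ξ) ∧
      ‖S‖ ≤ ‖π.hom‖ * ‖m‖ := by
  obtain ⟨l, hl, hl1⟩ := HasCAI.exists_filter (A := A)
  have hne := hl.neBot
  set D : ℝ := ‖π.hom‖ * ‖m‖ with hD
  have hD0 : 0 ≤ D := by positivity
  -- the operators `π(m e)` along the approximate identity
  have hbound : ∀ᶠ e in l, ∀ ξ, ‖π.hom (m.fst e) ξ‖ ≤ D * ‖ξ‖ := by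
    filter_upwards [hl1] with e he ξ
    refine (π.hom (m.fst e)).le_of_opNorm_le ?_ ξ
    refine (π.hom.le_opNorm _).trans (mul_le_mul_of_nonneg_left ?_ (norm_nonneg _))
    refine (m.fst.le_opNorm e).trans ?_
    calc ‖m.fst‖ * ‖e‖ ≤ ‖m‖ * 1 :=
          mul_le_mul (multiplier_norm_fst_le m) he (norm_nonneg _) (norm_nonneg _)
      _ = ‖m‖ := mul_one _
  have hspan : ∀ η ∈ Submodule.span ℂ {η : E | ∃ a ξ, η = π.hom a ξ},
      ∃ ζ, Tendsto (fun e => π.hom (m.fst e) η) l (𝓝 ζ) := by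
    intro η hη
    induction hη using Submodule.span_induction with
    | mem η h =>
      obtain ⟨a, ξ, rfl⟩ := h
      refine ⟨π.hom (m.fst a) ξ, ?_⟩
      have h1 : ∀ e, π.hom (m.fst e) (π.hom a ξ) = π.hom (m.fst (e * a)) ξ := fun e => by
        rw [fst_mul, π.map_mul]; rfl
      simp only [h1]
      have hc : Continuous fun b => π.hom (m.fst b) ξ := by fun_prop
      exact (hc.tendsto a).comp (hl.tendsto_mul_right a)
    | zero => exact ⟨0, by simp⟩
    | add x y _ _ hx hy =>
      obtain ⟨ζ, hζ⟩ := hx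
      obtain ⟨θ, hθ⟩ := hy
      exact ⟨ζ + θ, by simpa using hζ.add hθ⟩
    | smul c x _ hx =>
      obtain ⟨ζ, hζ⟩ := hx
      exact ⟨c • ζ, by simpa using hζ.const_smul c⟩
  have hall : ∀ η, ∃ ζ, Tendsto (fun e => π.hom (m.fst e) η) l (𝓝 ζ) := by
    intro η
    refine cauchy_map_iff_exists_tendsto.1 ?_
    rw [Metric.cauchy_iff]
    refine ⟨hne.map _, fun ε hε => ?_⟩
    obtain ⟨η', hη', hηd⟩ := Metric.dense_iff.1 π.nondegenerate η (ε / (4 * (D + 1)))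
      (by positivity)
    obtain ⟨ζ, hζ⟩ := hspan η' hηd
    have h4 : D * dist η' η < ε / 4 := by
      have : dist η' η < ε / (4 * (D + 1)) := hη'
      rw [lt_div_iff₀ (by positivity)] at this
      nlinarith [dist_nonneg (x := η') (y := η)]
    have hev : ∀ᶠ e in l, dist (π.hom (m.fst e) η) ζ < ε / 2 := by
      filter_upwards [hbound, (Metric.tendsto_nhds.1 hζ) (ε / 4) (by positivity)] with e h1 h2
      have h3 : dist (π.hom (m.fst e) η) (π.hom (m.fst e) η') ≤ D * dist η' η := by
        rw [dist_eq_norm, ← map_sub, dist_comm, dist_eq_norm]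
        exact h1 _
      linarith [dist_triangle (π.hom (m.fst e) η) (π.hom (m.fst e) η') ζ]
    refine ⟨{x | dist x ζ < ε / 2}, hev, fun x hx y hy => ?_⟩
    have hx' : dist x ζ < ε / 2 := hx
    have hy' : dist y ζ < ε / 2 := hy
    linarith [dist_triangle_right x y ζ]
  choose S hS using hall
  let SL : E →ₗ[ℂ] E :=
    { toFun := S
      map_add' := fun x y => tendsto_nhds_unique (hS (x + y)) (by simpa using (hS x).add (hS y))
      map_smul' := fun c x =>
        tendsto_nhds_unique (hS (c • x)) (by simpa using (hS x).const_smul c) }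
  have hSb : ∀ x, ‖SL x‖ ≤ D * ‖x‖ := fun x =>
    le_of_tendsto (hS x).norm (hbound.mono fun e he => he x)
  refine ⟨SL.mkContinuous D hSb, fun a ξ => ?_, SL.mkContinuous_norm_le hD0 hSb⟩
  refine tendsto_nhds_unique (hS (π.hom a ξ)) ?_
  have h1 : ∀ e, π.hom (m.fst e) (π.hom a ξ) = π.hom (m.fst (e * a)) ξ := fun e => by
    rw [fst_mul, π.map_mul]; rfl
  simp only [h1]
  have hc : Continuous fun b => π.hom (m.fst b) ξ := by fun_prop
  exact (hc.tendsto a).comp (hl.tendsto_mul_right a)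

variable [CompleteSpace E]

/-- The extension `π̂ : M(A) → B(E)` of a nondegenerate representation `π`: `π̂(m)` is the unique
bounded operator with `π̂(m) π(a) = π(ma)` for all `a`. -/
def NondegenerateRep.hat (π : NondegenerateRep A E) (m : 𝓜(ℂ, A)) : E →L[ℂ] E :=
  (π.exists_extension m).choose

theorem NondegenerateRep.hat_apply (π : NondegenerateRep A E) (m : 𝓜(ℂ, A)) (a : A) (ξ : E) :
    π.hat m (π.hom a ξ) = π.hom (m.fst a) ξ :=
  (π.exists_extension m).choose_spec.1 a ξ

theorem NondegenerateRep.norm_hat_le (π : NondegenerateRep A E) (m : 𝓜(ℂ, A)) :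
    ‖π.hat m‖ ≤ ‖π.hom‖ * ‖m‖ :=
  (π.exists_extension m).choose_spec.2

theorem NondegenerateRep.hat_one (π : NondegenerateRep A E) : π.hat 1 = 1 :=
  π.ext_of_eq fun a ξ => by simp [π.hat_apply]

theorem NondegenerateRep.hat_mul (π : NondegenerateRep A E) (m n : 𝓜(ℂ, A)) :
    π.hat (m * n) = π.hat m * π.hat n :=
  π.ext_of_eq fun a ξ => by simp [π.hat_apply]

theorem NondegenerateRep.hom_snd (π : NondegenerateRep A E) (m : 𝓜(ℂ, A)) (a : A) :
    π.hom (m.snd a) = π.hom a * π.hat m :=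
  π.ext_of_eq fun b ξ => by
    have h1 := DFunLike.congr_fun (π.map_mul (m.snd a) b) ξ
    have h2 := DFunLike.congr_fun (π.map_mul a (m.fst b)) ξ
    rw [m.central] at h1
    change π.hom (m.snd a) (π.hom b ξ) = π.hom a (π.hat m (π.hom b ξ))
    rw [π.hat_apply]
    exact h1.symm.trans h2

end Extension

section Actions

/-- A twisted action `(α, σ)` of `G` on `A`. -/
structure TwistedAction (G : Type*) [Group G] [TopologicalSpace G] (A : Type*)
    [NonUnitalNormedRing A] [NormedSpace ℂ A] [IsScalarTower ℂ A A] [SMulCommClass ℂ A A] where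
  /-- the map `α : G → Aut(A)` -/
  α : G → IsometricAut A
  /-- the twist `σ : G × G → Inv₁(M(A))` -/
  σ : G → G → (𝓜(ℂ, A))ˣ
  σ_mem : ∀ x y, σ x y ∈ Inv₁ A
  continuous_α : ∀ a, Continuous fun x => α x a
  continuous_σ_fst : ∀ a, Continuous fun p : G × G => (σ p.1 p.2 : 𝓜(ℂ, A)).fst a
  continuous_σ_snd : ∀ a, Continuous fun p : G × G => (σ p.1 p.2 : 𝓜(ℂ, A)).snd a
  α_one : ∀ a, α 1 a = a
  σ_one_left : ∀ x, σ 1 x = 1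
  σ_one_right : ∀ x, σ x 1 = 1
  α_α : ∀ x y a, α x (α y a) = Ad (σ x y) (α (x * y) a)
  cocycle : ∀ x y z, (α z).lift (σ x y) * σ z (x * y) = (σ z x * σ (z * x) y : 𝓜(ℂ, A))

variable {G : Type*} [Group G] [TopologicalSpace G] {A : Type*}
  [NonUnitalNormedRing A] [NormedSpace ℂ A] [IsScalarTower ℂ A A] [SMulCommClass ℂ A A]

/-- The twisted actions `S = (α, σ)` and `T = (β, ω)` are exterior equivalent via `θ`. -/
structure IsExteriorEquivalence (S T : TwistedAction G A) (θ : G → (𝓜(ℂ, A))ˣ) : Prop where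
  mem : ∀ x, θ x ∈ Inv₁ A
  continuous_fst : ∀ a, Continuous fun x => (θ x : 𝓜(ℂ, A)).fst a
  continuous_snd : ∀ a, Continuous fun x => (θ x : 𝓜(ℂ, A)).snd a
  Ad_α : ∀ x a, T.α x a = Ad (θ x) (S.α x a)
  twist : ∀ x y, (T.σ x y * θ (x * y) : 𝓜(ℂ, A)) = θ x * (S.α x).lift (θ y) * S.σ x y

/-- A covariant representation `(π, u)` of `(G, A, α, σ)` on a Banach space `E`. -/
structure CovariantRep [HasCAI A] (T : TwistedAction G A) where
  /-- the Banach space -/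
  E : Type w
  [normedAddCommGroup : NormedAddCommGroup E]
  [normedSpace : NormedSpace ℂ E]
  [completeSpace : CompleteSpace E]
  /-- the representation of the algebra -/
  π : NondegenerateRep A E
  /-- the map from `G` to the invertible isometries of `E` -/
  u : G → E ≃ₗᵢ[ℂ] E
  continuous_u : ∀ ξ, Continuous fun x => u x ξ
  u_u : ∀ x y ξ, u x (u y ξ) = π.hat (T.σ x y) (u (x * y) ξ)
  covariant : ∀ x a ξ, π.hom (T.α x a) ξ = u x (π.hom a ((u x).symm ξ))

attribute [instance] CovariantRep.normedAddCommGroup CovariantRep.normedSpace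
  CovariantRep.completeSpace

/-- A nonempty uniformly bounded family of covariant representations. -/
structure CovariantFamily [HasCAI A] (T : TwistedAction G A) where
  /-- the members of the family -/
  carrier : Set (CovariantRep.{w} T)
  nonempty : carrier.Nonempty
  uniformlyBounded : BddAbove {c : ℝ | ∃ r ∈ carrier, c = ‖r.π.hom‖}

/-- The family consists of contractive representations. -/
def CovariantFamily.IsContractive [HasCAI A] {T : TwistedAction G A}
    (R : CovariantFamily.{w} T) : Prop :=
  ∀ r ∈ R.carrier, ‖r.π.hom‖ ≤ 1

/-! ### The representations `(π, π̂(θ)u)` -/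

section Exterior

variable [HasCAI A] {S T : TwistedAction G A} {θ : G → (𝓜(ℂ, A))ˣ}

theorem CovariantRep.u_hat (r : CovariantRep.{w} S) (x : G) (m : 𝓜(ℂ, A)) (ξ : r.E) :
    r.u x (r.π.hat m ξ) = r.π.hat ((S.α x).lift m) (r.u x ξ) := by
  let V : r.E →L[ℂ] r.E := (r.u x).toContinuousLinearEquiv.toContinuousLinearMap
  have h : V ∘L r.π.hat m = r.π.hat ((S.α x).lift m) ∘L V := by
    refine r.π.ext_of_eq fun a η => ?_
    have hu : ∀ (b : A) (ζ : r.E), r.u x (r.π.hom b ζ) = r.π.hom (S.α x b) (r.u x ζ) :=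
      fun b ζ => by rw [r.covariant, LinearIsometryEquiv.symm_apply_apply]
    change r.u x (r.π.hat m (r.π.hom a η)) = r.π.hat _ (r.u x (r.π.hom a η))
    rw [r.π.hat_apply, hu, hu, r.π.hat_apply, IsometricAut.lift_fst]
  exact DFunLike.congr_fun h ξ

theorem NondegenerateRep.hat_unit_hat_inv {E : Type*} [NormedAddCommGroup E] [NormedSpace ℂ E]
    [CompleteSpace E] (π : NondegenerateRep A E) (v : (𝓜(ℂ, A))ˣ) (ξ : E) :
    π.hat v (π.hat ((v⁻¹ : (𝓜(ℂ, A))ˣ) : 𝓜(ℂ, A)) ξ) = ξ := by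
  have h := π.hat_mul v ((v⁻¹ : (𝓜(ℂ, A))ˣ) : 𝓜(ℂ, A))
  rw [Units.mul_inv, π.hat_one] at h
  exact (DFunLike.congr_fun h ξ).symm

theorem NondegenerateRep.hat_inv_hat_unit {E : Type*} [NormedAddCommGroup E] [NormedSpace ℂ E]
    [CompleteSpace E] (π : NondegenerateRep A E) (v : (𝓜(ℂ, A))ˣ) (ξ : E) :
    π.hat ((v⁻¹ : (𝓜(ℂ, A))ˣ) : 𝓜(ℂ, A)) (π.hat v ξ) = ξ := by
  have h := π.hat_mul ((v⁻¹ : (𝓜(ℂ, A))ˣ) : 𝓜(ℂ, A)) v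
  rw [Units.inv_mul, π.hat_one] at h
  exact (DFunLike.congr_fun h ξ).symm

theorem NondegenerateRep.norm_hat_apply_le {E : Type*} [NormedAddCommGroup E] [NormedSpace ℂ E]
    [CompleteSpace E] (π : NondegenerateRep A E) (hπ : ‖π.hom‖ ≤ 1) {m : 𝓜(ℂ, A)}
    (hm : ‖m‖ = 1) (ξ : E) : ‖π.hat m ξ‖ ≤ ‖ξ‖ := by
  have h : ‖π.hat m‖ ≤ 1 := (π.norm_hat_le m).trans (by rw [hm, mul_one]; exact hπ)
  simpa using (π.hat m).le_of_opNorm_le h ξ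

/-- For contractive `π` and `v ∈ Inv₁(M(A))` the operator `π̂(v)` is an invertible isometry. -/
def NondegenerateRep.hatIso {E : Type*} [NormedAddCommGroup E] [NormedSpace ℂ E]
    [CompleteSpace E] (π : NondegenerateRep A E) (hπ : ‖π.hom‖ ≤ 1) (v : (𝓜(ℂ, A))ˣ)
    (hv : v ∈ Inv₁ A) : E ≃ₗᵢ[ℂ] E where
  toFun := π.hat v
  map_add' := map_add _
  map_smul' := map_smul _
  invFun := π.hat ((v⁻¹ : (𝓜(ℂ, A))ˣ) : 𝓜(ℂ, A))
  left_inv := π.hat_inv_hat_unit v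
  right_inv := π.hat_unit_hat_inv v
  norm_map' := fun ξ => by
    refine le_antisymm (π.norm_hat_apply_le hπ hv.1 ξ) ?_
    have h := π.norm_hat_apply_le hπ hv.2 (π.hat v ξ)
    rw [π.hat_inv_hat_unit] at h
    exact h

theorem NondegenerateRep.continuous_hat {E : Type*} [NormedAddCommGroup E] [NormedSpace ℂ E]
    [CompleteSpace E] (π : NondegenerateRep A E) (hπ : ‖π.hom‖ ≤ 1)
    (hθ : ∀ x, θ x ∈ Inv₁ A) (hc : ∀ a, Continuous fun x => (θ x : 𝓜(ℂ, A)).fst a) (ξ : E) :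
    Continuous fun x => π.hat (θ x) ξ := by
  have hspan : ∀ η ∈ Submodule.span ℂ {η : E | ∃ a ξ, η = π.hom a ξ},
      Continuous fun x => π.hat (θ x) η := by
    intro η hη
    induction hη using Submodule.span_induction with
    | mem η h =>
      obtain ⟨a, ζ, rfl⟩ := h
      simp only [π.hat_apply]
      have h1 : Continuous fun b => π.hom b ζ := by fun_prop
      exact h1.comp (hc a)
    | zero => simpa using continuous_const
    | add x y _ _ hx hy => simp only [map_add]; fun_prop
    | smul c x _ hx => simp only [map_smul]; fun_prop
  rw [continuous_iff_continuousAt]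
  intro x₀
  rw [ContinuousAt, Metric.tendsto_nhds]
  intro ε hε
  obtain ⟨η, hη, hηd⟩ := Metric.dense_iff.1 π.nondegenerate ξ (ε / 3) (by positivity)
  filter_upwards [Metric.tendsto_nhds.1 ((hspan η hηd).tendsto x₀) (ε / 3) (by positivity)]
    with x hx
  have hd : ∀ y, dist (π.hat (θ y) ξ) (π.hat (θ y) η) < ε / 3 := by
    intro y
    rw [dist_eq_norm, ← map_sub]
    refine (π.norm_hat_apply_le hπ (hθ y).1 _).trans_lt ?_
    rw [← dist_eq_norm, dist_comm]
    exact hη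
  have h2 := hd x₀
  rw [dist_comm] at h2
  linarith [dist_triangle4 (π.hat (θ x) ξ) (π.hat (θ x) η) (π.hat (θ x₀) η) (π.hat (θ x₀) ξ), hd x]

/-- If `θ` implements an exterior equivalence of `(α, σ)` and `(β, ω)` and `(π, u)` is a
contractive covariant representation of `(G, A, α, σ)`, then `(π, v)` with
`v x = π̂(θ x) u x` is a covariant representation of `(G, A, β, ω)`. -/
def CovariantRep.exterior (h : IsExteriorEquivalence S T θ) (r : CovariantRep.{w} S)
    (hr : ‖r.π.hom‖ ≤ 1) : CovariantRep.{w} T where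
  E := r.E
  π := r.π
  u := fun x => (r.u x).trans (r.π.hatIso hr (θ x) (h.mem x))
  continuous_u := fun ξ =>
    OperatorField.continuous_apply
      (T := ⟨fun x => r.π.hat (θ x), ⟨1, fun x => by
        refine (r.π.norm_hat_le _).trans ?_
        rw [(h.mem x).1, mul_one]
        exact hr⟩, r.π.continuous_hat hr h.mem h.continuous_fst⟩) (r.continuous_u ξ)
  u_u := fun x y ξ => by
    change r.π.hat (θ x) (r.u x (r.π.hat (θ y) (r.u y ξ)))
      = r.π.hat (T.σ x y) (r.π.hat (θ (x * y)) (r.u (x * y) ξ))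
    have h1 := DFunLike.congr_fun (r.π.hat_mul (T.σ x y) (θ (x * y))) (r.u (x * y) ξ)
    refine Eq.trans ?_ h1
    rw [h.twist, r.u_hat, r.u_u, r.π.hat_mul, r.π.hat_mul]
    rfl
  covariant := fun x a ξ => by
    change r.π.hom (T.α x a) ξ = r.π.hat (θ x) (r.u x (r.π.hom a ((r.u x).symm
      (r.π.hat (((θ x)⁻¹ : (𝓜(ℂ, A))ˣ) : 𝓜(ℂ, A)) ξ))))
    rw [← r.covariant, r.π.hat_apply, h.Ad_α, Ad]
    rw [← snd_fst_comm, r.π.hom_snd]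
    rfl

/-- The family `R_θ = {(π, π̂(θ)u) : (π, u) ∈ R}`. -/
def CovariantFamily.exterior (h : IsExteriorEquivalence S T θ) (R : CovariantFamily.{w} S)
    (hR : R.IsContractive) : CovariantFamily.{w} T where
  carrier := {s | ∃ (r : CovariantRep.{w} S) (hr : r ∈ R.carrier), s = r.exterior h (hR r hr)}
  nonempty := by
    obtain ⟨r, hr⟩ := R.nonempty
    exact ⟨_, r, hr, rfl⟩
  uniformlyBounded := by
    refine ⟨1, ?_⟩
    rintro _ ⟨_, ⟨r, hr, rfl⟩, rfl⟩
    exact hR r hr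

end Exterior

end Actions

section Convolution

variable {G : Type*} [Group G] [TopologicalSpace G] [IsTopologicalGroup G] [LocallyCompactSpace G]
  [MeasurableSpace G] [BorelSpace G] (ν : Measure G) [ν.Regular]
  {A : Type*} [NonUnitalNormedRing A] [NormedSpace ℂ A]

section Integrated

variable {E : Type*} [NormedAddCommGroup E] [NormedSpace ℂ E]

/-- The field of operators `a ↦ π(a) u(x) ξ`. -/
def pairField (π : A →L[ℂ] (E →L[ℂ] E)) (u : OperatorField G E E) (ξ : E) :
    OperatorField G A E where
  op := fun x => π.flip (u.op x ξ)
  bounded := by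
    obtain ⟨C, hC0, hC⟩ := u.exists_bound
    exact ⟨‖π.flip‖ * (C * ‖ξ‖), fun x => (π.flip.le_opNorm _).trans
      (mul_le_mul_of_nonneg_left (hC x ξ) (norm_nonneg _))⟩
  continuous := fun a => (π a).continuous.comp (u.continuous ξ)

theorem integrable_pair (π : A →L[ℂ] (E →L[ℂ] E)) (u : OperatorField G E E)
    (f : Lp A 1 ν) (ξ : E) : Integrable (fun x => π (f x) (u.op x ξ)) ν :=
  (pairField π u ξ).integrable_apply (L1.integrable_coeFn f)

/-- The integrated form `f ↦ ∫ π(f(x)) u(x) dx` of a pair `(π, u)`, with values in `B(E)`; the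
integral converges in the strong operator topology. -/
def integratedForm (π : A →L[ℂ] (E →L[ℂ] E)) (u : OperatorField G E E) :
    Lp A 1 ν →L[ℂ] (E →L[ℂ] E) :=
  LinearMap.mkContinuousOfExistsBound₂
    (LinearMap.mk₂ ℂ (fun (f : Lp A 1 ν) (ξ : E) => ∫ x, π (f x) (u.op x ξ) ∂ν)
      (fun f g ξ => by
        rw [← integral_add (integrable_pair ν π u f ξ) (integrable_pair ν π u g ξ)]
        refine integral_congr_ae ?_
        filter_upwards [Lp.coeFn_add f g] with x hx
        rw [hx]
        simp)
      (fun c f ξ => by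
        rw [← integral_smul]
        refine integral_congr_ae ?_
        filter_upwards [Lp.coeFn_smul c f] with x hx
        rw [hx]
        simp)
      (fun f ξ η => by
        rw [← integral_add (integrable_pair ν π u f ξ) (integrable_pair ν π u f η)]
        refine integral_congr_ae (Eventually.of_forall fun x => ?_)
        simp)
      (fun c f ξ => by
        rw [← integral_smul]
        refine integral_congr_ae (Eventually.of_forall fun x => ?_)
        simp)) <| by
    obtain ⟨C, hC0, hC⟩ := u.exists_bound
    refine ⟨‖π‖ * C, fun f ξ => ?_⟩
    rw [LinearMap.mk₂_apply]
    refine (norm_integral_le_integral_norm _).trans ?_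
    rw [L1.norm_eq_integral_norm f, mul_right_comm, mul_comm _ (∫ x, ‖f x‖ ∂ν),
      mul_comm (∫ x, ‖f x‖ ∂ν), ← integral_const_mul]
    refine integral_mono (integrable_pair ν π u f ξ).norm
      ((L1.integrable_coeFn f).norm.const_mul _) fun x => ?_
    calc ‖π (f x) (u.op x ξ)‖ ≤ ‖π‖ * ‖f x‖ * ‖u.op x ξ‖ := π.le_opNorm₂ _ _
      _ ≤ ‖π‖ * ‖f x‖ * (C * ‖ξ‖) := by gcongr; exact hC x ξ
      _ = ‖π‖ * C * ‖ξ‖ * ‖f x‖ := by ring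

theorem integratedForm_apply (π : A →L[ℂ] (E →L[ℂ] E)) (u : OperatorField G E E)
    (f : Lp A 1 ν) (ξ : E) : integratedForm ν π u f ξ = ∫ x, π (f x) (u.op x ξ) ∂ν := rfl

theorem norm_integratedForm_le (π : A →L[ℂ] (E →L[ℂ] E)) (u : OperatorField G E E)
    (hu : ∀ x ξ, ‖u.op x ξ‖ ≤ ‖ξ‖) (f : Lp A 1 ν) :
    ‖integratedForm ν π u f‖ ≤ ‖π‖ * ‖f‖ := by
  refine ContinuousLinearMap.opNorm_le_bound _ (by positivity) fun ξ => ?_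
  rw [integratedForm_apply]
  refine (norm_integral_le_integral_norm _).trans ?_
  rw [L1.norm_eq_integral_norm f, mul_right_comm, ← integral_const_mul]
  refine integral_mono (integrable_pair ν π u f ξ).norm
    ((L1.integrable_coeFn f).norm.const_mul _) fun x => ?_
  calc ‖π (f x) (u.op x ξ)‖ ≤ ‖π‖ * ‖f x‖ * ‖u.op x ξ‖ := π.le_opNorm₂ _ _
    _ ≤ ‖π‖ * ‖f x‖ * ‖ξ‖ := by gcongr; exact hu x ξ
    _ = ‖π‖ * ‖ξ‖ * ‖f x‖ := by ring

end Integrated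

variable [ν.IsHaarMeasure] [IsScalarTower ℂ A A] [SMulCommClass ℂ A A]

/-- Left multiplication `(a f)(x) = a f(x)` of `A` on `L¹(G; A)`. -/
def leftMul : A →L[ℂ] (Lp A 1 ν →L[ℂ] Lp A 1 ν) :=
  LinearMap.mkContinuous
    { toFun := fun a => (ContinuousLinearMap.mul ℂ A a).compLpL 1 ν
      map_add' := fun a b => by rw [map_add, ContinuousLinearMap.add_compLpL]
      map_smul' := fun c a => by
        rw [map_smul, ContinuousLinearMap.smul_compLpL, RingHom.id_apply] } 1 fun a => by
    rw [one_mul]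
    refine (ContinuousLinearMap.norm_compLpL_le _).trans ?_
    exact ContinuousLinearMap.opNorm_mul_apply_le ℂ A a

theorem coeFn_leftMul (a : A) (f : Lp A 1 ν) : leftMul ν a f =ᵐ[ν] fun x => a * f x :=
  (ContinuousLinearMap.mul ℂ A a).coeFn_compLpL f

/-- Left translation `g ↦ (x ↦ g(y⁻¹x))` on `L¹(G; A)`. -/
def translate (y : G) : Lp A 1 ν →ₗᵢ[ℂ] Lp A 1 ν :=
  Lp.compMeasurePreservingₗᵢ ℂ (fun x => y⁻¹ * x) (measurePreserving_mul_left ν y⁻¹)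

theorem coeFn_translate (y : G) (g : Lp A 1 ν) : translate ν y g =ᵐ[ν] fun x => g (y⁻¹ * x) :=
  Lp.coeFn_compMeasurePreserving g (measurePreserving_mul_left ν y⁻¹)

theorem continuous_translate (g : Lp A 1 ν) : Continuous fun y => translate ν y g := by
  let c : C(G, C(G, G)) := (ContinuousMap.mk (fun p : G × G => p.1⁻¹ * p.2) (by fun_prop)).curry
  exact Continuous.compMeasurePreservingLp (f := fun _ : G => g) (g := fun y => c y)
    continuous_const c.continuous (fun y => measurePreserving_mul_left ν y⁻¹) ENNReal.one_ne_top

namespace TwistedAction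

variable (T : TwistedAction G A)

/-- The operators `a ↦ α_y(a) σ_{y,y⁻¹x}` on `A`, as a field over `x ∈ G`. -/
def twistField (y : G) : OperatorField G A A where
  op := fun x => (T.σ y (y⁻¹ * x) : 𝓜(ℂ, A)).snd ∘L
    (T.α y).toLinearIsometryEquiv.toContinuousLinearEquiv.toContinuousLinearMap
  bounded := ⟨1, fun x => ContinuousLinearMap.opNorm_le_bound _ zero_le_one fun a => by
    refine ((T.σ y (y⁻¹ * x) : 𝓜(ℂ, A)).snd.le_of_opNorm_le
      ((multiplier_norm_snd_le _).trans (T.σ_mem y _).1.le) _).trans ?_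
    exact (congrArg (1 * ·) ((T.α y).toLinearIsometryEquiv.norm_map a)).le⟩
  continuous := fun a => (T.continuous_σ_snd (T.α y a)).comp (by fun_prop :
    Continuous fun x => (y, y⁻¹ * x))

theorem twistField_apply (x y : G) (a : A) :
    (T.twistField y).op x a = (T.σ y (y⁻¹ * x) : 𝓜(ℂ, A)).snd (T.α y a) := rfl

theorem norm_twistField_le (x y : G) (a : A) : ‖(T.twistField y).op x a‖ ≤ ‖a‖ := by
  have h := (T.σ y (y⁻¹ * x) : 𝓜(ℂ, A)).snd.le_of_opNorm_le
      ((multiplier_norm_snd_le _).trans (T.σ_mem y _).1.le) (T.α y a)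
  rw [one_mul] at h
  exact h.trans ((T.α y).toLinearIsometryEquiv.norm_map a).le

theorem continuous_twistField (a : A) :
    Continuous fun p : G × G => (T.twistField p.1).op p.2 a := by
  have h : Continuous fun p : G × G => (T.σ p.1 (p.1⁻¹ * p.2) : 𝓜(ℂ, A)).snd (T.α p.1 a) :=
    OperatorField.continuous_apply (X := G × G)
      (T := ⟨fun p => (T.σ p.1 (p.1⁻¹ * p.2) : 𝓜(ℂ, A)).snd,
        ⟨1, fun p => (multiplier_norm_snd_le _).trans (T.σ_mem _ _).1.le⟩,
        fun b => (T.continuous_σ_snd b).comp (by fun_prop :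
          Continuous fun p : G × G => (p.1, p.1⁻¹ * p.2))⟩)
      ((T.continuous_α a).comp continuous_fst)
  exact h

/-- The operators `(λ(y) g)(x) = α_y(g(y⁻¹x)) σ_{y,y⁻¹x}` on `L¹(G; A)`, as a field over
`y ∈ G`. -/
def translationField : OperatorField G (Lp A 1 ν) (Lp A 1 ν) where
  op := fun y => (T.twistField y).mapL1 ν ∘L (translate ν y).toContinuousLinearMap
  bounded := by
    refine ⟨1, fun y => ContinuousLinearMap.opNorm_le_bound _ zero_le_one fun g => ?_⟩
    refine ((T.twistField y).norm_mapL1_le zero_le_one (fun x a => ?_) _).trans ?_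
    · rw [one_mul]
      exact T.norm_twistField_le x y a
    · exact (congrArg (1 * ·) ((translate ν y).norm_map g)).le
  continuous := fun g => OperatorField.continuous_apply
    (T := OperatorField.mapL1Field T.twistField ⟨1, fun y x =>
      ContinuousLinearMap.opNorm_le_bound _ zero_le_one fun a => by
        rw [one_mul]; exact T.norm_twistField_le x y a⟩ T.continuous_twistField ν)
    (continuous_translate ν g)

theorem coeFn_translationField (y : G) (g : Lp A 1 ν) :
    (T.translationField ν).op y g =ᵐ[ν]
      fun x => (T.σ y (y⁻¹ * x) : 𝓜(ℂ, A)).snd (T.α y (g (y⁻¹ * x))) := by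
  filter_upwards [(T.twistField y).coeFn_mapL1 (translate ν y g), coeFn_translate ν y g]
    with x h1 h2
  refine h1.trans ?_
  rw [h2, twistField_apply]

/-- The twisted convolution on `L¹(G; A)`,
`(f * g)(x) = ∫ f(y) α_y(g(y⁻¹x)) σ_{y,y⁻¹x} dy`, i.e. `f * g = ∫ f(y) (λ(y) g) dy` as a Bochner
integral in `L¹(G; A)` with `(λ(y) g)(x) = α_y(g(y⁻¹x)) σ_{y,y⁻¹x}`. -/
def convolution : Lp A 1 ν →L[ℂ] Lp A 1 ν →L[ℂ] Lp A 1 ν :=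
  integratedForm ν (leftMul ν) (T.translationField ν)

theorem convolution_apply (f g : Lp A 1 ν) :
    T.convolution ν f g = ∫ y, leftMul ν (f y) ((T.translationField ν).op y g) ∂ν := rfl

/-- Integrated forms of covariant pairs are multiplicative. -/
theorem integratedForm_convolution [CompleteSpace A] {E : Type*} [NormedAddCommGroup E]
    [NormedSpace ℂ E] [CompleteSpace E] (π : A →L[ℂ] (E →L[ℂ] E)) (u : OperatorField G E E)
    (hπ : ∀ a b, π (a * b) = π a * π b)
    (hu : ∀ a y z ξ, π ((T.σ y z : 𝓜(ℂ, A)).snd (T.α y a)) (u.op (y * z) ξ)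
      = u.op y (π a (u.op z ξ))) (f g : Lp A 1 ν) :
    integratedForm ν π u (T.convolution ν f g)
      = integratedForm ν π u f * integratedForm ν π u g := by
  ext ξ
  let Ψ : Lp A 1 ν →L[ℂ] E := (integratedForm ν π u).flip ξ
  have hint := integrable_pair ν (leftMul ν) (T.translationField ν) f g
  have h1 : Ψ (T.convolution ν f g)
      = ∫ y, Ψ (leftMul ν (f y) ((T.translationField ν).op y g)) ∂ν := by
    rw [convolution_apply]
    exact (Ψ.integral_comp_comm hint).symm
  change Ψ (T.convolution ν f g) = integratedForm ν π u f (integratedForm ν π u g ξ)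
  rw [h1, integratedForm_apply]
  refine integral_congr_ae (Eventually.of_forall fun y => ?_)
  change ∫ x, π ((leftMul ν (f y) ((T.translationField ν).op y g) : Lp A 1 ν) x) (u.op x ξ) ∂ν
    = π (f y) (u.op y (integratedForm ν π u g ξ))
  have hg : Integrable (fun x => π (g x) (u.op x ξ)) ν :=
    integrable_pair ν π u g ξ
  let V : E →L[ℂ] E := π (f y) * u.op y
  have h2 : ∫ x, V (π (g x) (u.op x ξ)) ∂ν = V (∫ x, π (g x) (u.op x ξ) ∂ν) :=
    V.integral_comp_comm hg
  refine Eq.trans ?_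
    ((integral_mul_left_eq_self (fun x => V (π (g x) (u.op x ξ))) y⁻¹).trans h2)
  refine integral_congr_ae ?_
  filter_upwards [coeFn_leftMul ν (f y) ((T.translationField ν).op y g),
    T.coeFn_translationField ν y g] with x hx1 hx2
  rw [hx1, hx2, hπ]
  have h3 := hu (g (y⁻¹ * x)) y (y⁻¹ * x) ξ
  rw [mul_inv_cancel_left] at h3
  exact congrArg (π (f y)) h3

theorem snd_σ [HasCAI A] (x y : G) (a : A) :
    (T.σ x y : 𝓜(ℂ, A)).snd (T.α x (T.α y a)) = (T.σ x y : 𝓜(ℂ, A)).fst (T.α (x * y) a) := by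
  rw [T.α_α, Ad, snd_fst_comm, snd_snd_inv]

theorem convolution_assoc [HasCAI A] [CompleteSpace A] (f g h : Lp A 1 ν) :
    T.convolution ν (T.convolution ν f g) h = T.convolution ν f (T.convolution ν g h) := by
  have key := T.integratedForm_convolution ν (leftMul ν) (T.translationField ν) (fun a b => ?_)
    (fun a y z ξ => ?_) f g
  · exact DFunLike.congr_fun key h
  · ext1 ξ
    refine Lp.ext ?_
    filter_upwards [coeFn_leftMul ν (a * b) ξ, coeFn_leftMul ν a (leftMul ν b ξ),
      coeFn_leftMul ν b ξ] with x h1 h2 h3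
    refine h1.trans (Eq.symm (h2.trans ?_))
    rw [h3, mul_assoc]
  · refine Lp.ext ?_
    have hq : ∀ᵐ x ∂ν, leftMul ν a ((T.translationField ν).op z ξ) (y⁻¹ * x)
        = a * (T.σ z (z⁻¹ * (y⁻¹ * x)) : 𝓜(ℂ, A)).snd (T.α z (ξ (z⁻¹ * (y⁻¹ * x)))) := by
      have h0 := (measurePreserving_mul_left ν y⁻¹).quasiMeasurePreserving
      have h1 := h0.ae (coeFn_leftMul ν a ((T.translationField ν).op z ξ))
      have h2 := h0.ae (T.coeFn_translationField ν z ξ)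
      filter_upwards [h1, h2] with x h1 h2
      rw [h1, h2]
    filter_upwards [coeFn_leftMul ν ((T.σ y z : 𝓜(ℂ, A)).snd (T.α y a))
        ((T.translationField ν).op (y * z) ξ), T.coeFn_translationField ν (y * z) ξ,
      T.coeFn_translationField ν y (leftMul ν a ((T.translationField ν).op z ξ)), hq]
      with x h1 h2 h3 h4
    rw [h1, h2, h3, h4]
    have hw : (y * z)⁻¹ * x = z⁻¹ * (y⁻¹ * x) := by rw [mul_inv_rev, mul_assoc]
    have hyx : y⁻¹ * x = z * (z⁻¹ * (y⁻¹ * x)) := by rw [mul_inv_cancel_left]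
    rw [hw]
    generalize z⁻¹ * (y⁻¹ * x) = w at hyx ⊢
    rw [hyx]
    generalize (ξ w : A) = b
    have hc := T.cocycle z w y
    rw [← snd_mul, (T.σ y z : 𝓜(ℂ, A)).central, ← snd_σ, snd_mul, IsometricAut.map_mul, snd_mul]
    congr 1
    have hc' := congrArg (fun m : 𝓜(ℂ, A) => m.snd (T.α y (T.α z b))) hc
    simp only [DoubleCentralizer.mul_snd] at hc'
    refine Eq.trans hc'.symm ?_
    change (T.σ y (z * w) : 𝓜(ℂ, A)).snd (((T.α y).lift (T.σ z w)).snd (T.α y (T.α z b))) = _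
    rw [IsometricAut.lift_snd]

end TwistedAction

end Convolution

open scoped Pointwise in
/-- For continuous compactly supported functions the twisted convolution is given by the usual
pointwise formula. -/
theorem TwistedAction.convolution_toL1 {G : Type*} [Group G] [TopologicalSpace G]
    [IsTopologicalGroup G] [LocallyCompactSpace G] [MeasurableSpace G] [BorelSpace G]
    (ν : Measure G) [ν.Regular] [ν.IsHaarMeasure] {A : Type*} [NonUnitalNormedRing A]
    [NormedSpace ℂ A] [IsScalarTower ℂ A A] [SMulCommClass ℂ A A] [CompleteSpace A]
    (T : TwistedAction G A) {f g : G → A} (hf : Continuous f) (hfs : HasCompactSupport f)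
    (hg : Continuous g) (hgs : HasCompactSupport g) (hfi : Integrable f ν)
    (hgi : Integrable g ν) :
    T.convolution ν (hfi.toL1 f) (hgi.toL1 g) =ᵐ[ν]
      fun x => ∫ y, f y * (T.σ y (y⁻¹ * x) : 𝓜(ℂ, A)).snd (T.α y (g (y⁻¹ * x))) ∂ν := by
  let Φ : G → G → A := fun y x => f y * (T.σ y (y⁻¹ * x) : 𝓜(ℂ, A)).snd (T.α y (g (y⁻¹ * x)))
  have hΦ : Continuous fun p : G × G => Φ p.1 p.2 :=
    (hf.comp continuous_fst).mul (OperatorField.continuous_apply (X := G × G)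
      (T := ⟨fun p => (T.twistField p.1).op p.2, ⟨1, fun p =>
        ContinuousLinearMap.opNorm_le_bound _ zero_le_one fun a => by
          rw [one_mul]; exact T.norm_twistField_le p.2 p.1 a⟩, T.continuous_twistField⟩)
      (hg.comp (by fun_prop : Continuous fun p : G × G => p.1⁻¹ * p.2)))
  let K : Set G := closure (tsupport f * tsupport g)
  have hK : IsCompact K := (hfs.mul hgs).closure
  have hKm : MeasurableSet K := isClosed_closure.measurableSet
  have hout : ∀ y x, x ∉ K → Φ y x = 0 := by
    intro y x hx
    by_cases hy : y ∈ tsupport f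
    · have hyx : y⁻¹ * x ∉ tsupport g := fun h => hx (subset_closure
        ⟨y, hy, y⁻¹ * x, h, mul_inv_cancel_left y x⟩)
      have h0 : T.α y (g (y⁻¹ * x)) = 0 := by
        rw [image_eq_zero_of_notMem_tsupport hyx]
        exact map_zero (T.α y).toLinearIsometryEquiv
      change f y * (T.σ y (y⁻¹ * x) : 𝓜(ℂ, A)).snd (T.α y (g (y⁻¹ * x))) = 0
      rw [h0, map_zero, mul_zero]
    · change f y * _ = 0
      rw [image_eq_zero_of_notMem_tsupport hy, zero_mul]
  have : CompactSpace K := isCompact_iff_compactSpace.1 hK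
  classical
  let e : C(K, A) → G → A := fun h x => if hx : x ∈ K then h ⟨x, hx⟩ else 0
  have hein : ∀ h x (hx : x ∈ K), e h x = h ⟨x, hx⟩ := fun h x hx => dif_pos hx
  have heout : ∀ h x, x ∉ K → e h x = 0 := fun h x hx => dif_neg hx
  have heb : ∀ h x, ‖e h x‖ ≤ K.indicator (fun _ => ‖h‖) x := by
    intro h x
    by_cases hx : x ∈ K
    · rw [hein h x hx, Set.indicator_of_mem hx]
      exact h.norm_coe_le_norm _
    · rw [heout h x hx, Set.indicator_of_notMem hx, norm_zero]
  have hei : ∀ h, Integrable (e h) ν := by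
    intro h
    have hc : ContinuousOn (e h) K := by
      rw [continuousOn_iff_continuous_domRestrict]
      have : K.domRestrict (e h) = h := funext fun x => hein h x x.2
      rw [this]
      exact h.continuous
    have hind : K.indicator (e h) = e h := by
      rw [Set.indicator_eq_self]
      intro x hx
      by_contra hxK
      exact hx (heout h x hxK)
    have hm : AEStronglyMeasurable (e h) ν := by
      rw [← hind, aestronglyMeasurable_indicator_iff hKm]
      exact hc.aestronglyMeasurable_of_isCompact hK hKm
    refine Integrable.mono' ((integrable_indicator_iff hKm).2
      (integrableOn_const hK.measure_ne_top)) hm (Eventually.of_forall (heb h))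
  let L : C(K, A) →L[ℂ] Lp A 1 ν :=
    LinearMap.mkContinuous
      { toFun := fun h => (hei h).toL1 (e h)
        map_add' := fun h k => by
          rw [← Integrable.toL1_add]
          refine (Integrable.toL1_eq_toL1_iff _ _ _ _).2 (Eventually.of_forall fun x => ?_)
          by_cases hx : x ∈ K
          · simp [hein _ x hx]
          · simp [heout _ x hx]
        map_smul' := fun c h => by
          rw [RingHom.id_apply, ← Integrable.toL1_smul]
          refine (Integrable.toL1_eq_toL1_iff _ _ _ _).2 (Eventually.of_forall fun x => ?_)
          by_cases hx : x ∈ K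
          · simp [hein _ x hx]
          · simp [heout _ x hx] } (ν.real K) fun h => by
      refine (le_of_eq (L1.norm_of_fun_eq_integral_norm (hei h))).trans ?_
      refine (integral_mono (hei h).norm ((integrable_indicator_iff hKm).2
        (integrableOn_const hK.measure_ne_top)) (heb h)).trans (le_of_eq ?_)
      rw [integral_indicator hKm, setIntegral_const, smul_eq_mul]
  have hL : ∀ h, L h =ᵐ[ν] e h := fun h => (hei h).coeFn_toL1
  let H : C(G, C(K, A)) :=
    (ContinuousMap.mk (fun p : G × K => Φ p.1 p.2)
      (hΦ.comp (by fun_prop : Continuous fun p : G × K => (p.1, (p.2 : G))))).curry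
  have hHs : HasCompactSupport H := by
    refine hfs.mono fun y hy h0 => hy ?_
    ext x
    change f y * _ = 0
    rw [h0, zero_mul]
  have hHi : Integrable H ν := H.continuous.integrable_of_hasCompactSupport hHs
  have hconv : T.convolution ν (hfi.toL1 f) (hgi.toL1 g) = L (∫ y, H y ∂ν) := by
    rw [T.convolution_apply ν, ← L.integral_comp_comm hHi]
    refine integral_congr_ae ?_
    filter_upwards [hfi.coeFn_toL1] with y hy
    rw [hy]
    refine Lp.ext ?_
    have h0 := (measurePreserving_mul_left ν y⁻¹).quasiMeasurePreserving.ae hgi.coeFn_toL1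
    filter_upwards [coeFn_leftMul ν (f y) ((T.translationField ν).op y (hgi.toL1 g)),
      T.coeFn_translationField ν y (hgi.toL1 g), hL (H y), h0] with x h1 h2 h3 h4
    rw [h1, h2, h3, h4]
    by_cases hx : x ∈ K
    · rw [hein _ x hx]
      rfl
    · rw [heout _ x hx]
      exact hout y x hx
  rw [hconv]
  filter_upwards [hL (∫ y, H y ∂ν)] with x hx
  rw [hx]
  by_cases hxK : x ∈ K
  · rw [hein _ x hxK]
    exact ((ContinuousMap.evalCLM ℂ (⟨x, hxK⟩ : K) : C(K, A) →L[ℂ] A).integral_comp_comm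
      hHi).symm
  · rw [heout _ x hxK]
    refine Eq.symm (integral_eq_zero_of_ae (Eventually.of_forall fun y => ?_))
    exact hout y x hxK

section Completion

open UniformSpace

variable (α : Type*) [NonUnitalSeminormedRing α]

/-- The continuous extension of the product of `α` to its Hausdorff completion. -/
abbrev completionMul : Mul (Completion α) where
  mul a b := (Completion.isDenseInducing_coe.prodMap Completion.isDenseInducing_coe).extend
    (fun p : α × α => ((p.1 * p.2 : α) : Completion α)) (a, b)

attribute [local instance] completionMul

variable {α} in
theorem completion_coe_mul (a b : α) : ((a * b : α) : Completion α) = a * b :=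
  ((Completion.isDenseInducing_coe.prodMap Completion.isDenseInducing_coe).extend_eq
    ((Completion.continuous_coe α).comp (continuous_mul (M := α))) (a, b)).symm

theorem completion_continuousMul : ContinuousMul (Completion α) where
  continuous_mul := by
    let m : α →+ α →+ Completion α :=
      (AddMonoidHom.mul : α →+ α →+ α).compr₂ Completion.toCompl
    have h : Continuous fun p : α × α => m p.1 p.2 :=
      (Completion.continuous_coe α).comp continuous_mul
    have di : IsDenseInducing (Completion.toCompl : α → Completion α) :=
      Completion.isDenseInducing_coe
    exact (di.extend_Z_bilin di h :)

attribute [local instance] completion_continuousMul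

/-- The Hausdorff completion of a seminormed ring, as a normed ring. -/
abbrev completionRing : NonUnitalNormedRing (Completion α) :=
  { (inferInstance : NormedAddCommGroup (Completion α)), completionMul α with
    left_distrib := fun a b c =>
      Completion.induction_on₃ a b c (isClosed_eq (by fun_prop) (by fun_prop)) fun a b c => by
        rw [← Completion.coe_add, ← completion_coe_mul, ← completion_coe_mul,
          ← completion_coe_mul, ← Completion.coe_add, mul_add]
    right_distrib := fun a b c =>
      Completion.induction_on₃ a b c (isClosed_eq (by fun_prop) (by fun_prop)) fun a b c => by
        rw [← Completion.coe_add, ← completion_coe_mul, ← completion_coe_mul,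
          ← completion_coe_mul, ← Completion.coe_add, add_mul]
    mul_assoc := fun a b c =>
      Completion.induction_on₃ a b c (isClosed_eq (by fun_prop) (by fun_prop)) fun a b c => by
        rw [← completion_coe_mul, ← completion_coe_mul, ← completion_coe_mul,
          ← completion_coe_mul, mul_assoc]
    zero_mul := fun a =>
      Completion.induction_on a (isClosed_eq (by fun_prop) continuous_const) fun a => by
        rw [← Completion.coe_zero, ← completion_coe_mul, zero_mul]
    mul_zero := fun a =>
      Completion.induction_on a (isClosed_eq (by fun_prop) continuous_const) fun a => by
        rw [← Completion.coe_zero, ← completion_coe_mul, mul_zero]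
    norm_mul_le := fun a b =>
      Completion.induction_on₂ a b (isClosed_le (by fun_prop) (by fun_prop)) fun a b => by
        rw [← completion_coe_mul, Completion.norm_coe, Completion.norm_coe, Completion.norm_coe]
        exact norm_mul_le a b }

end Completion

section CrossedProduct

variable {G : Type*} [Group G] [TopologicalSpace G] [IsTopologicalGroup G] [LocallyCompactSpace G]
  [MeasurableSpace G] [BorelSpace G]
  {A : Type*} [NonUnitalNormedRing A] [NormedSpace ℂ A] [IsScalarTower ℂ A A]
  [SMulCommClass ℂ A A] [HasCAI A] {T : TwistedAction G A}

/-- The isometries `u x` as a field of operators. -/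
def CovariantRep.uField (r : CovariantRep.{w} T) : OperatorField G r.E r.E where
  op := fun x => (r.u x).toContinuousLinearEquiv.toContinuousLinearMap
  bounded := ⟨1, fun x => ContinuousLinearMap.opNorm_le_bound _ zero_le_one fun ξ =>
    ((r.u x).norm_map ξ).le.trans (one_mul _).ge⟩
  continuous := r.continuous_u

/-- The integrated representation `(π ⋊ u)(f) = ∫ π(f(x)) u(x) dx`. -/
def CovariantRep.integrated (r : CovariantRep.{w} T) (ν : Measure G) [ν.Regular] :
    Lp A 1 ν →L[ℂ] (r.E →L[ℂ] r.E) :=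
  integratedForm ν r.π.hom r.uField

theorem CovariantRep.integrated_apply (r : CovariantRep.{w} T) (ν : Measure G) [ν.Regular]
    (f : Lp A 1 ν) (ξ : r.E) : r.integrated ν f ξ = ∫ x, r.π.hom (f x) (r.u x ξ) ∂ν := rfl

theorem CovariantRep.integrated_convolution [CompleteSpace A] (r : CovariantRep.{w} T)
    (ν : Measure G) [ν.Regular] [ν.IsHaarMeasure] (f g : Lp A 1 ν) :
    r.integrated ν (T.convolution ν f g) = r.integrated ν f * r.integrated ν g := by
  refine T.integratedForm_convolution ν r.π.hom r.uField r.π.map_mul (fun a y z ξ => ?_) f g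
  change r.π.hom ((T.σ y z : 𝓜(ℂ, A)).snd (T.α y a)) (r.u (y * z) ξ)
    = r.u y (r.π.hom a (r.u z ξ))
  have h := r.covariant y a (r.u y (r.u z ξ))
  rw [LinearIsometryEquiv.symm_apply_apply] at h
  rw [← h, r.u_u, r.π.hom_snd]
  rfl

/-- The seminorm `‖f‖_R = sup {‖(π ⋊ u)(f)‖ : (π, u) ∈ R}` on `L¹(G; A)`. -/
def CovariantFamily.seminorm (R : CovariantFamily.{w} T) (ν : Measure G) [ν.Regular]
    (f : Lp A 1 ν) : ℝ :=
  sSup {c : ℝ | ∃ r ∈ R.carrier, c = ‖r.integrated ν f‖}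

theorem CovariantFamily.bddAbove (R : CovariantFamily.{w} T) (ν : Measure G) [ν.Regular]
    (f : Lp A 1 ν) : BddAbove {c : ℝ | ∃ r ∈ R.carrier, c = ‖r.integrated ν f‖} := by
  obtain ⟨C, hC⟩ := R.uniformlyBounded
  refine ⟨C * ‖f‖, ?_⟩
  rintro _ ⟨r, hr, rfl⟩
  refine (norm_integratedForm_le ν r.π.hom r.uField (fun x ξ => ((r.u x).norm_map ξ).le) f).trans ?_
  exact mul_le_mul_of_nonneg_right (hC ⟨r, hr, rfl⟩) (norm_nonneg _)

theorem CovariantFamily.norm_integrated_le (R : CovariantFamily.{w} T) (ν : Measure G)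
    [ν.Regular] {r : CovariantRep.{w} T} (hr : r ∈ R.carrier) (f : Lp A 1 ν) :
    ‖r.integrated ν f‖ ≤ R.seminorm ν f :=
  le_csSup (R.bddAbove ν f) ⟨r, hr, rfl⟩

theorem CovariantFamily.seminorm_le (R : CovariantFamily.{w} T) (ν : Measure G)
    [ν.Regular] {f : Lp A 1 ν} {c : ℝ} (h : ∀ r ∈ R.carrier, ‖r.integrated ν f‖ ≤ c) :
    R.seminorm ν f ≤ c := by
  obtain ⟨r, hr⟩ := R.nonempty
  refine csSup_le ⟨_, r, hr, rfl⟩ ?_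
  rintro _ ⟨r, hr, rfl⟩
  exact h r hr

theorem CovariantFamily.seminorm_nonneg (R : CovariantFamily.{w} T) (ν : Measure G)
    [ν.Regular] (f : Lp A 1 ν) : 0 ≤ R.seminorm ν f := by
  obtain ⟨r, hr⟩ := R.nonempty
  exact (norm_nonneg _).trans (R.norm_integrated_le ν hr f)

theorem CovariantFamily.seminorm_neg (R : CovariantFamily.{w} T) (ν : Measure G) [ν.Regular]
    (f : Lp A 1 ν) : R.seminorm ν (-f) = R.seminorm ν f := by
  simp only [CovariantFamily.seminorm, map_neg, norm_neg]

/-- The algebra `L¹(G, A, α, σ)`, i.e. `L¹(G; A)` with the twisted convolution as product,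
equipped with the seminorm `‖·‖_R`. -/
def TwistedL1 (_R : CovariantFamily.{w} T) (ν : Measure G) [ν.Regular] : Type _ := Lp A 1 ν

variable (R : CovariantFamily.{w} T) (ν : Measure G) [ν.Regular]

instance : AddCommGroup (TwistedL1 R ν) := inferInstanceAs (AddCommGroup (Lp A 1 ν))

instance : Module ℂ (TwistedL1 R ν) := inferInstanceAs (Module ℂ (Lp A 1 ν))

variable [CompleteSpace A] [ν.IsHaarMeasure]

instance : NonUnitalRing (TwistedL1 R ν) where
  mul f g := T.convolution ν f g
  left_distrib f g h := map_add (T.convolution ν f) g h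
  right_distrib f g h := DFunLike.congr_fun (map_add (T.convolution ν) f g) h
  zero_mul f := DFunLike.congr_fun (map_zero (T.convolution ν)) f
  mul_zero f := map_zero (T.convolution ν f)
  mul_assoc f g h := T.convolution_assoc ν f g h

instance : NonUnitalSeminormedRing (TwistedL1 R ν) where
  __ := AddGroupSeminorm.toSeminormedAddCommGroup (E := TwistedL1 R ν)
    { toFun := R.seminorm ν
      map_zero' := by
        refine le_antisymm (R.seminorm_le ν fun r _ => ?_) (R.seminorm_nonneg ν _)
        exact (congrArg norm (map_zero (r.integrated ν))).le.trans norm_zero.le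
      add_le' := fun f g => R.seminorm_le ν fun r hr => by
        refine (congrArg norm (map_add (r.integrated ν) f g)).le.trans ((norm_add_le _ _).trans ?_)
        exact add_le_add (R.norm_integrated_le ν hr f) (R.norm_integrated_le ν hr g)
      neg' := fun f => R.seminorm_neg ν f }
  __ := (inferInstance : NonUnitalRing (TwistedL1 R ν))
  norm_mul_le f g := R.seminorm_le ν fun r hr => by
    refine (congrArg norm (r.integrated_convolution ν f g)).le.trans ((norm_mul_le _ _).trans ?_)
    exact mul_le_mul (R.norm_integrated_le ν hr f) (R.norm_integrated_le ν hr g) (norm_nonneg _)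
      (R.seminorm_nonneg ν f)

theorem TwistedL1.norm_def (f : TwistedL1 R ν) : ‖f‖ = R.seminorm ν f := rfl

theorem TwistedL1.mul_def (f g : TwistedL1 R ν) : f * g = T.convolution ν f g := rfl

instance : NormedSpace ℂ (TwistedL1 R ν) where
  norm_smul_le c f := R.seminorm_le ν fun r hr => by
    refine (congrArg norm (map_smul (r.integrated ν) c f)).le.trans ((norm_smul_le _ _).trans ?_)
    exact mul_le_mul_of_nonneg_left (R.norm_integrated_le ν hr f) (norm_nonneg _)

instance : IsScalarTower ℂ (TwistedL1 R ν) (TwistedL1 R ν) where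
  smul_assoc c f g := DFunLike.congr_fun (map_smul (T.convolution ν) c f) g

instance : SMulCommClass ℂ (TwistedL1 R ν) (TwistedL1 R ν) where
  smul_comm c f g := (map_smul (T.convolution ν f) c g).symm

/-- The twisted Banach crossed product `F_R(G, A, α, σ)`: the Hausdorff completion of
`L¹(G, A, α, σ)` with respect to the seminorm `‖·‖_R`. -/
def CrossedProduct : Type _ := UniformSpace.Completion (TwistedL1 R ν)

/-- The product of `F_R(G, A, α, σ)` is the continuous extension of the twisted convolution. -/
instance : NonUnitalNormedRing (CrossedProduct R ν) :=
  completionRing (TwistedL1 R ν)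

instance : NormedSpace ℂ (CrossedProduct R ν) :=
  inferInstanceAs (NormedSpace ℂ (UniformSpace.Completion (TwistedL1 R ν)))

instance : CompleteSpace (CrossedProduct R ν) :=
  inferInstanceAs (CompleteSpace (UniformSpace.Completion (TwistedL1 R ν)))

/-- The canonical map `τ_R : L¹(G, A, α, σ) → F_R(G, A, α, σ)`. -/
def CrossedProduct.of : TwistedL1 R ν →ₗᵢ[ℂ] CrossedProduct R ν :=
  UniformSpace.Completion.toComplₗᵢ

theorem CrossedProduct.denseRange_of : DenseRange (CrossedProduct.of R ν) :=
  UniformSpace.Completion.denseRange_coe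

theorem CrossedProduct.of_mul (f g : TwistedL1 R ν) :
    CrossedProduct.of R ν (f * g) = CrossedProduct.of R ν f * CrossedProduct.of R ν g :=
  completion_coe_mul f g

end CrossedProduct

end TwistedCrossedProduct

end

open TwistedCrossedProduct

noncomputable section

namespace TwistedCrossedProduct

universe w

/-! ### Right multiplication by a strictly continuous family in `Inv₁(M(A))`, on `A` and on `L¹(G;
A)`. -/

section Multipliers

variable {G : Type*} [TopologicalSpace G] {A : Type*} [NonUnitalNormedRing A] [NormedSpace ℂ A]
  [IsScalarTower ℂ A A] [SMulCommClass ℂ A A]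

/-! The isomorphism is induced by `φ(f)(x) = f(x) θ_x⁻¹`. For `(π, u)` in `R`, the partner in `R_θ`
is `(π, π̂(θ)u)`, and `π(f(x) θ_x⁻¹) π̂(θ_x) u_x = π(f(x)) u_x` for almost every `x`. So the
integrated form of the partner at `φ(f)` is the same operator as that of `(π, u)` at `f`
(`CovariantRep.integrated_exterior`). Taking suprema, `φ` carries the seminorm of `R` to that of
`R_θ` (`CovariantFamily.seminorm_exterior`). It is bijective because right multiplication by `θ_x`
undoes it. For `φ` to act on `L¹` at all, `x ↦ a θ_x⁻¹` must be continuous; this follows from the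
norm bound in `Inv₁(M(A))` (`continuous_snd_inv`).

Multiplicativity needs no calculation with the twists. Both integrated forms turn convolution into
composition of operators, so every representation in `R_θ` sends `φ(f * g)` and `φ(f) * φ(g)` to the
same operator. Their difference is a null vector of the seminorm and vanishes in the Hausdorff
completion (`CovariantFamily.seminorm_exterior_convolution`). The relations defining exterior
equivalence enter through `CovariantRep.exterior`, where they make the pair `(π, π̂(θ)u)` covariant
for `(β, ω)`; contractivity of `π` is what makes `π̂(θ_x)` isometric there. A seminorm-preserving
linear bijection then extends to a surjective isometry of the completions, and multiplicativity
passes to the limit by density. -/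

theorem inv_mem_Inv₁ {v : (𝓜(ℂ, A))ˣ} (hv : v ∈ Inv₁ A) : v⁻¹ ∈ Inv₁ A :=
  ⟨hv.2, by rw [inv_inv]; exact hv.1⟩

/-- The bound does not depend on `v`. Applied to `θ_x⁻¹` for varying `x`, it is the uniform estimate
behind the continuity of the inverse. -/
theorem norm_snd_apply_le {v : (𝓜(ℂ, A))ˣ} (hv : v ∈ Inv₁ A) (a : A) :
    ‖(v : 𝓜(ℂ, A)).snd a‖ ≤ ‖a‖ := by
  simpa using (v : 𝓜(ℂ, A)).snd.le_of_opNorm_le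
    ((multiplier_norm_snd_le _).trans hv.1.le) a

/-- The cancellation `(a v) v⁻¹ = a`, complementing `(a v⁻¹) v = a` from `snd_snd_inv`; a two-sided
inverse on `L¹` needs both. -/
theorem snd_inv_snd (v : (𝓜(ℂ, A))ˣ) (a : A) :
    ((v⁻¹ : (𝓜(ℂ, A))ˣ) : 𝓜(ℂ, A)).snd ((v : 𝓜(ℂ, A)).snd a) = a := by
  simpa using snd_snd_inv v⁻¹ a

/-- Inversion is strictly continuous on `Inv₁(M(A))`: if `x ↦ a θ_x` is continuous for all `a`,
then so is `x ↦ a θ_x⁻¹`. -/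
theorem continuous_snd_inv {θ : G → (𝓜(ℂ, A))ˣ} (hθ : ∀ x, θ x ∈ Inv₁ A)
    (hc : ∀ a, Continuous fun x => (θ x : 𝓜(ℂ, A)).snd a) (a : A) :
    Continuous fun x => (((θ x)⁻¹ : (𝓜(ℂ, A))ˣ) : 𝓜(ℂ, A)).snd a := by
  rw [continuous_iff_continuousAt]
  intro x₀
  -- With `b = a θ_{x₀}⁻¹`, the value at `x₀`, one has `a = b θ_{x₀}`. Hence `a θ_x⁻¹ - b = (b
  -- θ_{x₀} - b θ_x) θ_x⁻¹`, whose norm is at most `‖b θ_x - b θ_{x₀}‖`. Strict continuity of `θ` at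
  -- the single vector `b` therefore suffices.
  set b := (((θ x₀)⁻¹ : (𝓜(ℂ, A))ˣ) : 𝓜(ℂ, A)).snd a with hb
  have hab : (θ x₀ : 𝓜(ℂ, A)).snd b = a := snd_snd_inv _ a
  rw [ContinuousAt, tendsto_iff_norm_sub_tendsto_zero]
  have hlim := tendsto_iff_norm_sub_tendsto_zero.1 ((hc b).tendsto x₀)
  refine squeeze_zero (fun _ => norm_nonneg _) (fun x => ?_) hlim
  -- Contractivity of right multiplication by `θ_x⁻¹`, applied to `b θ_x - a`; the rewriting turns
  -- the left side into `‖a θ_x⁻¹ - b‖`.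
  have h := norm_snd_apply_le (inv_mem_Inv₁ (hθ x)) ((θ x : 𝓜(ℂ, A)).snd b - a)
  rw [map_sub, snd_inv_snd, norm_sub_rev] at h
  rwa [hab]

/-- The operators `a ↦ a θ_x` as a field of operators over `x ∈ G`. -/
def rightMulField (θ : G → (𝓜(ℂ, A))ˣ) (hθ : ∀ x, θ x ∈ Inv₁ A)
    (hc : ∀ a, Continuous fun x => (θ x : 𝓜(ℂ, A)).snd a) : OperatorField G A A where
  op := fun x => (θ x : 𝓜(ℂ, A)).snd
  bounded := ⟨1, fun x => (multiplier_norm_snd_le _).trans (hθ x).1.le⟩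
  continuous := hc

variable [MeasurableSpace G] [BorelSpace G] [R1Space G] [LocallyCompactSpace G]

/-- The linear automorphism `(f(x))_x ↦ (f(x) θ_x⁻¹)_x` of `L¹(G; A)`. -/
def rightMulInvL1 (ν : Measure G) [ν.Regular] (θ : G → (𝓜(ℂ, A))ˣ) (hθ : ∀ x, θ x ∈ Inv₁ A)
    (hc : ∀ a, Continuous fun x => (θ x : 𝓜(ℂ, A)).snd a) : Lp A 1 ν ≃ₗ[ℂ] Lp A 1 ν :=
  LinearEquiv.ofLinearMap
    -- The forward map multiplies by `θ_x⁻¹` and the backward map by `θ_x`. Only the linear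
    -- structure is recorded: the norms compared later are the seminorms of `R` and `R_θ`, not the
    -- `L¹` norm.
    ((rightMulField (fun x => (θ x)⁻¹) (fun x => inv_mem_Inv₁ (hθ x))
      (continuous_snd_inv hθ hc)).mapL1 ν).toLinearMap
    ((rightMulField θ hθ hc).mapL1 ν).toLinearMap
    -- Elements of `L¹` are classes, so the cancellation `(f(x) θ_x) θ_x⁻¹ = f(x)` is available only
    -- where the representatives of both the outer and the inner image have their expected values,
    -- which is almost everywhere.
    (LinearMap.ext fun f => Lp.ext <| by
      filter_upwards [(rightMulField (fun x => (θ x)⁻¹) (fun x => inv_mem_Inv₁ (hθ x))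
        (continuous_snd_inv hθ hc)).coeFn_mapL1 ((rightMulField θ hθ hc).mapL1 ν f),
        (rightMulField θ hθ hc).coeFn_mapL1 f] with x h1 h2
      refine h1.trans ?_
      rw [h2]
      exact snd_inv_snd (θ x) (f x))
    (LinearMap.ext fun f => Lp.ext <| by
      filter_upwards [(rightMulField θ hθ hc).coeFn_mapL1
        ((rightMulField (fun x => (θ x)⁻¹) (fun x => inv_mem_Inv₁ (hθ x))
          (continuous_snd_inv hθ hc)).mapL1 ν f),
        (rightMulField (fun x => (θ x)⁻¹) (fun x => inv_mem_Inv₁ (hθ x))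
          (continuous_snd_inv hθ hc)).coeFn_mapL1 f] with x h1 h2
      refine h1.trans ?_
      rw [h2]
      exact snd_snd_inv (θ x) (f x))

theorem coeFn_rightMulInvL1 (ν : Measure G) [ν.Regular] {θ : G → (𝓜(ℂ, A))ˣ}
    (hθ : ∀ x, θ x ∈ Inv₁ A) (hc : ∀ a, Continuous fun x => (θ x : 𝓜(ℂ, A)).snd a)
    (f : Lp A 1 ν) : rightMulInvL1 ν θ hθ hc f =ᵐ[ν]
      fun x => (((θ x)⁻¹ : (𝓜(ℂ, A))ˣ) : 𝓜(ℂ, A)).snd (f x) :=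
  OperatorField.coeFn_mapL1 _ f

end Multipliers

/-! ### Comparison of the integrated forms and seminorms of `R` and `R_θ`. -/

section Exterior

variable {G : Type*} [Group G] [TopologicalSpace G] [IsTopologicalGroup G] [LocallyCompactSpace G]
  [MeasurableSpace G] [BorelSpace G] (ν : Measure G) [ν.Regular]
  {A : Type*} [NonUnitalNormedRing A] [NormedSpace ℂ A] [IsScalarTower ℂ A A]
  [SMulCommClass ℂ A A] [HasCAI A] {S T : TwistedAction G A} {θ : G → (𝓜(ℂ, A))ˣ}

/-- The integrated form of `(π, π̂(θ)u)` at `x ↦ f(x) θ_x⁻¹` is that of `(π, u)` at `f`. -/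
theorem CovariantRep.integrated_exterior (hθ : IsExteriorEquivalence S T θ)
    (r : CovariantRep.{w} S) (hr : ‖r.π.hom‖ ≤ 1) (f : Lp A 1 ν) :
    (r.exterior hθ hr).integrated ν (rightMulInvL1 ν θ hθ.mem hθ.continuous_snd f)
      = r.integrated ν f := by
  -- Both representations act on the same space with the same `π`, definitionally, so the two
  -- operators can be compared on vectors of `r.E`.
  refine ContinuousLinearMap.ext fun (ξ : r.E) => ?_
  refine ((r.exterior hθ hr).integrated_apply ν _ ξ).trans
    (Eq.trans (integral_congr_ae ?_) (r.integrated_apply ν f ξ).symm)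
  filter_upwards [coeFn_rightMulInvL1 ν hθ.mem hθ.continuous_snd f] with x hx
  rw [hx]
  change r.π.hom ((((θ x)⁻¹ : (𝓜(ℂ, A))ˣ) : 𝓜(ℂ, A)).snd (f x)) (r.π.hat (θ x) (r.u x ξ)) = _
  -- `π(a θ_x⁻¹) = π(a) π̂(θ_x⁻¹)`, and the factor `π̂(θ_x⁻¹)` cancels against `π̂(θ_x)`.
  rw [r.π.hom_snd]
  exact congrArg (r.π.hom (f x)) (r.π.hat_inv_hat_unit (θ x) (r.u x ξ))

/-- The members of `R_θ` are exactly the partners of members of `R`, and partners give the same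
operator, so the two suprema run over the same set of norms. -/
theorem CovariantFamily.seminorm_exterior (hθ : IsExteriorEquivalence S T θ)
    (R : CovariantFamily.{w} S) (hR : R.IsContractive) (f : Lp A 1 ν) :
    (R.exterior hθ hR).seminorm ν (rightMulInvL1 ν θ hθ.mem hθ.continuous_snd f)
      = R.seminorm ν f := by
  refine le_antisymm ((R.exterior hθ hR).seminorm_le ν ?_) (R.seminorm_le ν fun r hr => ?_)
  · rintro _ ⟨r, hr, rfl⟩
    exact (congrArg norm (r.integrated_exterior ν hθ (hR r hr) f)).le.trans
      (R.norm_integrated_le ν hr f)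
  · exact (congrArg norm (r.integrated_exterior ν hθ (hR r hr) f)).ge.trans
      ((R.exterior hθ hR).norm_integrated_le ν ⟨r, hr, rfl⟩ _)

variable [CompleteSpace A] [ν.IsHaarMeasure]

/-- Multiplicativity modulo null vectors, which is all that the Hausdorff completion sees. Writing
`ρ` for the integrated form of `(π, u)` and `ρ'` for that of its partner, `ρ'(φ(f * g)) = ρ(f * g) =
ρ(f) ρ(g) = ρ'(φ(f)) ρ'(φ(g)) = ρ'(φ(f) * φ(g))`, where the first product is twisted by `(α, σ)` and
the last by `(β, ω)`. -/
theorem CovariantFamily.seminorm_exterior_convolution (hθ : IsExteriorEquivalence S T θ)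
    (R : CovariantFamily.{w} S) (hR : R.IsContractive) (f g : Lp A 1 ν) :
    (R.exterior hθ hR).seminorm ν
      (rightMulInvL1 ν θ hθ.mem hθ.continuous_snd (S.convolution ν f g)
        - T.convolution ν (rightMulInvL1 ν θ hθ.mem hθ.continuous_snd f)
          (rightMulInvL1 ν θ hθ.mem hθ.continuous_snd g)) = 0 := by
  refine le_antisymm ((R.exterior hθ hR).seminorm_le ν ?_) ((R.exterior hθ hR).seminorm_nonneg ν _)
  rintro _ ⟨r, hr, rfl⟩
  rw [map_sub, CovariantRep.integrated_convolution]
  have e := r.integrated_exterior ν hθ (hR r hr)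
  have h := r.integrated_convolution ν f g
  -- Transports the multiplicativity of the integrated form of `(π, u)` to its partner: each of the
  -- operators at `f * g`, `f` and `g` is replaced by the partner's operator at the image under `φ`.
  rw [← e, ← e f, ← e g] at h
  rw [h]
  exact (congrArg norm (sub_self _)).le.trans norm_zero.le

end Exterior

end TwistedCrossedProduct

end

/-! ### Passage to the Hausdorff completions. -/

theorem mainTheorem2
    {G : Type*} [Group G] [TopologicalSpace G] [IsTopologicalGroup G] [LocallyCompactSpace G]
    [MeasurableSpace G] [BorelSpace G] (ν : Measure G) [ν.IsHaarMeasure] [ν.Regular]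
    {A : Type*} [NonUnitalNormedRing A] [NormedSpace ℂ A] [IsScalarTower ℂ A A]
    [SMulCommClass ℂ A A] [CompleteSpace A] [HasCAI A] (hA : IsNondegenerate A)
    (S T : TwistedAction G A) (θ : G → (𝓜(ℂ, A))ˣ) (hθ : IsExteriorEquivalence S T θ)
    (R : CovariantFamily S) (hR : R.IsContractive) :
    ∃ Φ : CrossedProduct R ν ≃ₗᵢ[ℂ] CrossedProduct (R.exterior hθ hR) ν,
      ∀ a b, Φ (a * b) = Φ a * Φ b := by
  -- Both sides have `Lp A 1 ν` as underlying space and differ only in seminorm and product, so the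
  -- linear bijection of `L¹` is reused as it stands.
  let φ : TwistedL1 R ν ≃ₗ[ℂ] TwistedL1 (R.exterior hθ hR) ν :=
    rightMulInvL1 ν θ hθ.mem hθ.continuous_snd
  let e₁ := (CrossedProduct.of R ν).toLinearMap
  let e₂ := (CrossedProduct.of (R.exterior hθ hR) ν).toLinearMap
  have hd₁ : DenseRange e₁ := CrossedProduct.denseRange_of R ν
  have hd₂ : DenseRange e₂ := CrossedProduct.denseRange_of _ ν
  have hn : ∀ f, ‖e₂ (φ f)‖ = ‖e₁ f‖ := fun f =>
    ((CrossedProduct.of _ ν).norm_map (φ f)).trans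
      ((R.seminorm_exterior ν hθ hR f).trans ((CrossedProduct.of R ν).norm_map f).symm)
  -- The identity is asserted only after `e₂`, which kills every vector of seminorm zero, the
  -- difference of the two sides in particular.
  have hφ : ∀ f g, e₂ (φ (f * g)) = e₂ (φ f * φ g) := fun f g => by
    rw [← sub_eq_zero, ← map_sub, ← norm_eq_zero]
    exact ((CrossedProduct.of _ ν).norm_map _).trans
      (R.seminorm_exterior_convolution ν hθ hR f g)
  -- Density of both ranges is used: that of `e₁` to extend `φ`, that of `e₂` to extend its inverse,
  -- which makes the extension surjective.
  let Φ := φ.extendOfIsometry e₁ e₂ hd₁ hd₂ hn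
  have hΦ : ∀ f, Φ (e₁ f) = e₂ (φ f) := φ.extendOfIsometry_eq e₁ e₂ hd₁ hd₂ hn
  refine ⟨Φ, fun a b => hd₁.induction_on₂
    -- Both sides are jointly continuous in `(a, b)`, so equality on the dense image of `L¹` is
    -- enough.
    (p := fun a b => Φ (a * b) = Φ a * Φ b) (isClosed_eq ?_ ?_) (fun f g => ?_) a b⟩
  · exact Φ.continuous.comp continuous_mul
  · exact (Φ.continuous.comp continuous_fst).mul (Φ.continuous.comp continuous_snd)
  · have h1 : e₁ (f * g) = e₁ f * e₁ g := CrossedProduct.of_mul R ν f g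
    rw [← h1, hΦ, hΦ, hΦ, hφ]
    exact CrossedProduct.of_mul _ ν _ _
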